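/- Let $n\ge 3$ and $k\ge 0$ be integers. Let $\mathfrak g=\mathfrak{sp}_{2n}(\mathbb C)$ (type $\mathsf C_n$), with weight lattice $P=\mathbb Z\varepsilon_1\oplus\cdots\oplus\mathbb Z\varepsilon_n$ and positive roots $\varepsilon_i\pm\varepsilon_j$ ($1\le i<j\le n$) and $2\varepsilon_i$ ($1\le i\le n$). Put $\mathbf I_n=\{-n,\dots,-1,1,\dots,n\}$ and $\varepsilon_{-a}=-\varepsilon_a$. In the field of fractions of the group algebra $\mathbb C(q)[P]$, spanned over $\mathbb C(q)$ by the formal exponentials $e^{\mu}$ ($\mu\in P$), let $x_a=e^{\varepsilon_a}$ for $a\in\mathbf I_n$ and \[ \mathbf{Ch}\,G_{n,k}=\sum_{a\in\mathbf I_n}\frac{q^2x_a-q^{-2}x_a^{-1}}{x_a-x_a^{-1}}\;x_a^{k}\prod_{b\in\mathbf I_n\setminus\{\pm a\}}\frac{q x_a-q^{-1}x_b}{x_a-x_b}. \] For $0\le r\le 2n$ put $\bar r=\min\{r,\,2n-r,\,n-1\}$, \[ \lambda_k^r=(k-r)\varepsilon_1+\varepsilon_2+\cdots+\varepsilon_{\bar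 r+1},\qquad \tau_r=\begin{cases}1,&0\le r\le n-1,\\ 0,&r=n,\\ -1,&n+1\le r\le 2n,\end{cases} \] and, for a dominant weight $\lambda$, let $\chi(\lambda)=\sum_{\mu}\dim L(\lambda)_\mu\,e^{\mu}$ be the character of the finite-dimensional simple $\mathfrak g$-module $L(\lambda)$ of highest weight $\lambda$ (the weight $\lambda_k^r$ is dominant whenever $r\le k-1$). Then \[ \mathbf{Ch}\,G_{n,k}= \begin{cases} \displaystyle\sum_{r=0}^{n-1}q^{2n-2r}+\sum_{r=n+1}^{2n}q^{2n-2r}, & \text{if } k=0,\\[2ex] \displaystyle -q^{-k}+\sum_{r=0}^{k-1}(-1)^r\tau_r\,q^{2n-2r}\chi(\lambda_k^r), & \text{if } 1\le k\le 2n \text{ and } k \text{ is even},\\[2ex] \displaystyle \sum_{r=0}^{\min\{k-1,2n\}}(-1)^r\tau_r\,q^{2n-2r}\chi(\lambda_k^r), & \text{otherwise.} \end{cases} \] -/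

import Mathlib

namespace TypeC

noncomputable section

attribute [local instance] LieRing.ofAssociativeRing

/-! ### Weights and positive roots of type `C_n`

The weight lattice is `ℤε₁ ⊕ ⋯ ⊕ ℤεₙ`; a weight is its vector of coordinates. The basis
vector `ε_{i+1}` of the usual numbering is the one at the index `i : Fin n`. -/

/-- The weight lattice of type `C_n`. -/
abbrev Weight (n : ℕ) : Type := Fin n → ℤ

/-- The basis weight `ε_i`. -/
def eps {n : ℕ} (i : Fin n) : Weight n := Pi.single i 1

/-- The positive roots `ε_i ± ε_j` (`i < j`) and `2ε_i`. -/
def positiveRoots (n : ℕ) : Set (Weight n) :=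
  {α | (∃ i j : Fin n, i < j ∧ (α = eps i - eps j ∨ α = eps i + eps j)) ∨
    ∃ i : Fin n, α = 2 • eps i}

/-- The value `μ(h) = ∑ μ_i h_i` of a weight at the Cartan element with coordinates `h`. -/
def evalWeight {n : ℕ} (μ : Weight n) (h : Fin n → ℂ) : ℂ := ∑ i, (μ i : ℂ) * h i

/-! ### Simple modules of `𝔰𝔭_{2n}(ℂ)` and their characters -/

/-- The simple Lie algebra `𝔰𝔭_{2n}(ℂ)`. -/
abbrev Sp (n : ℕ) : LieSubalgebra ℂ (Matrix (Fin n ⊕ Fin n) (Fin n ⊕ Fin n) ℂ) :=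
  LieAlgebra.Symplectic.sp (Fin n) ℂ

/-- The element `diag(h₁, …, hₙ, -h₁, …, -hₙ)` of the diagonal Cartan subalgebra. -/
def cartan {n : ℕ} (h : Fin n → ℂ) : Sp n :=
  ⟨Matrix.fromBlocks (Matrix.diagonal h) 0 0 (-Matrix.diagonal h), by
    rw [Sp, LieAlgebra.Symplectic.sp, mem_skewAdjointMatricesLieSubalgebra,
      mem_skewAdjointMatricesSubmodule]
    simp only [Matrix.IsSkewAdjoint, Matrix.IsAdjointPair, Matrix.J, Matrix.fromBlocks_transpose,
      Matrix.fromBlocks_multiply, Matrix.fromBlocks_neg]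
    congr 1 <;> simp⟩

section Modules

variable {n : ℕ} (V : Type) [AddCommGroup V] [Module ℂ V] [LieRingModule (Sp n) V]
  [LieModule ℂ (Sp n) V]

/-- The weight space `V_μ`. -/
def weightSpace (μ : Weight n) : Submodule ℂ V :=
  ⨅ h : Fin n → ℂ,
    Module.End.eigenspace (LieModule.toEnd ℂ (Sp n) V (cartan h)) (evalWeight μ h)

/-- `v` is a highest weight vector of weight `lam`: a nonzero vector of weight `lam` that is
annihilated by every root vector of a positive root. -/
def IsHighestWeightVector (lam : Weight n) (v : V) : Prop :=
  v ≠ 0 ∧ v ∈ weightSpace V lam ∧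
    ∀ α ∈ positiveRoots n, ∀ x : Sp n,
      (∀ h : Fin n → ℂ, ⁅cartan h, x⁆ = evalWeight α h • x) → ⁅x, v⁆ = 0

end Modules

/-- A finite-dimensional simple `𝔰𝔭_{2n}(ℂ)`-module of highest weight `lam`. -/
structure SimpleModuleOfHighestWeight (n : ℕ) (lam : Weight n) where
  /-- The underlying space. -/
  carrier : Type
  [addCommGroup : AddCommGroup carrier]
  [module : Module ℂ carrier]
  [lieRingModule : LieRingModule (Sp n) carrier]
  [lieModule : LieModule ℂ (Sp n) carrier]
  finiteDimensional : FiniteDimensional ℂ carrier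
  irreducible : LieModule.IsIrreducible ℂ (Sp n) carrier
  exists_highestWeightVector : ∃ v : carrier, IsHighestWeightVector carrier lam v

attribute [instance] SimpleModuleOfHighestWeight.addCommGroup
attribute [instance] SimpleModuleOfHighestWeight.module
attribute [instance] SimpleModuleOfHighestWeight.lieRingModule
attribute [instance] SimpleModuleOfHighestWeight.lieModule

/-! ### The ring in which the characters live -/

/-- The ground field `ℂ(q)`. -/
abbrev K : Type := RatFunc ℂ

/-- The group algebra over `ℂ(q)` of the weight lattice, spanned by the formal exponentials. -/
abbrev GroupAlg (n : ℕ) : Type := AddMonoidAlgebra K (Weight n)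

/-- The field of fractions of the group algebra of the weight lattice. -/
abbrev Frac (n : ℕ) : Type := FractionRing (GroupAlg n)

/-- The formal exponential `e^μ`. -/
def expo {n : ℕ} (μ : Weight n) : Frac n :=
  algebraMap (GroupAlg n) (Frac n) (AddMonoidAlgebra.single μ 1)

/-- The indeterminate `q`, as an element of the field of fractions. -/
def q (n : ℕ) : Frac n :=
  algebraMap (GroupAlg n) (Frac n) (algebraMap K (GroupAlg n) RatFunc.X)

/-- The character `∑ μ, dim(V_μ) e^μ` of a module; the sum is finite when `V` is
finite-dimensional. -/
def character {n : ℕ} (V : Type) [AddCommGroup V] [Module ℂ V] [LieRingModule (Sp n) V]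
    [LieModule ℂ (Sp n) V] : Frac n :=
  ∑ᶠ μ : Weight n, (Module.finrank ℂ (weightSpace V μ) : Frac n) * expo μ

open Classical in
/-- `χ(lam)`, the character of the finite-dimensional simple module `L(lam)` of highest weight
`lam`, which is unique up to isomorphism (and `0` if there is none, that is, if `lam` is not
dominant). -/
def chi {n : ℕ} (lam : Weight n) : Frac n :=
  if h : Nonempty (SimpleModuleOfHighestWeight n lam) then character h.some.carrier else 0

/-! ### The element `G_{n,k}` and its image -/

/-- The index set `{-n, …, -1, 1, …, n}`: the pair `(i, s)` stands for the index `± (i + 1)`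
whose sign is `s`. -/
abbrev Idx (n : ℕ) : Type := Fin n × ℤˣ

/-- The index `-a`. -/
def Idx.opp {n : ℕ} (a : Idx n) : Idx n := (a.1, -a.2)

/-- The weight `ε_a`, with `ε_{-a} = -ε_a`. -/
def epsIdx {n : ℕ} (a : Idx n) : Weight n := (a.2 : ℤ) • eps a.1

/-- `P_{n,a} = ∏_{b ≠ ± a} (q L_a - q⁻¹ L_b) / (L_a - L_b)`. -/
def P {F : Type} [Field F] (n : ℕ) (q : F) (L : Idx n → F) (a : Idx n) : F :=
  ∏ b ∈ Finset.univ \ {a, a.opp}, (q * L a - q⁻¹ * L b) / (L a - L b)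

/-- `G_{n,k} = ∑_a (q² L_a - q⁻² L_a⁻¹) / (L_a - L_a⁻¹) · L_a^k · P_{n,a}`, as an expression
in `q` and in the `L_a`. -/
def G {F : Type} [Field F] (n k : ℕ) (q : F) (L : Idx n → F) : F :=
  ∑ a : Idx n,
    (q ^ 2 * L a - (q ^ 2)⁻¹ * (L a)⁻¹) / (L a - (L a)⁻¹) * L a ^ k * P n q L a

/-- `Ch G_{n,k}`: the expression `G_{n,k}` with each `L_a` replaced by `e^{ε_a}`. -/
def ChG (n k : ℕ) : Frac n := G n k (q n) fun a => expo (epsIdx a)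

/-! ### The hook weights and the signs -/

/-- `r̄ = min {r, 2n - r, n - 1}` for `0 ≤ r ≤ 2n`. -/
def rbar (n r : ℕ) : ℕ := min r (min (2 * n - r) (n - 1))

/-- `λ_k^r = (k - r) ε₁ + ε₂ + ⋯ + ε_{r̄ + 1}`. -/
def hookWeight (n k r : ℕ) : Weight n := fun i =>
  if (i : ℕ) = 0 then (k : ℤ) - r else if (i : ℕ) ≤ rbar n r then 1 else 0

/-- The sign `τ_r`: `1` for `r ≤ n - 1`, `0` for `r = n`, and `-1` for `n + 1 ≤ r`. -/
def tau (n r : ℕ) : ℤ := if r < n then 1 else if r = n then 0 else -1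

/-- The summand `(-1)^r τ_r q^{2n - 2r} χ(λ_k^r)`. -/
def hookTerm (n k r : ℕ) : Frac n :=
  (-1) ^ r * (tau n r : Frac n) * q n ^ (2 * (n : ℤ) - 2 * (r : ℤ)) * chi (hookWeight n k r)

end

end TypeC

/-
Let `D` be the Weyl denominator. The product `D · G_{n,k}` is a sum, over the signed indices, of
Weyl denominators in which one variable is scaled by `q²`; expanding these determinants along rows
and resumming along columns writes it as `∑_j q^{2ρ_j} A(ρ + k ε_j) + q^{-2ρ_j} A(ρ - k ε_j)` with
alternants `A`. Each of these alternants vanishes, or equals `± D`, or is up to a sign `A(λ + ρ)`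
for a hook weight `λ`, and `A(λ + ρ) = D · χ(λ)` is the Weyl character formula.

The character formula is proved with the Casimir operator. It acts on `L(λ)` by a scalar, and
comparing its traces on the weight spaces with this scalar shows that `D · χ(λ)` is an eigenvector
of the Laplacian `e^μ ↦ (μ, μ) e^μ`, so it is supported on the sphere through `λ + ρ`. Being
antisymmetric under the Weyl group, it is then a multiple of `A(λ + ρ)`, since every other strictly
dominant weight that can occur is shorter than `λ + ρ`. Finally `L(λ)` exists for every dominant
`λ`, because products of minors of a generic matrix are highest weight vectors of all dominant
weights.
-/

namespace TypeC

noncomputable section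

attribute [local instance] LieRing.ofAssociativeRing

/-! ### Alternants and the Weyl denominator -/

section Alternant

variable {F : Type*} [Field F] {n : ℕ}

/-- The odd Laurent monomial `x ^ m - x ^ (-m)`. -/
def oddPow (x : F) (m : ℤ) : F := x ^ m - x ^ (-m)

@[simp] lemma oddPow_zero (x : F) : oddPow x 0 = 0 := by simp [oddPow]

@[simp] lemma oddPow_neg (x : F) (m : ℤ) : oddPow x (-m) = -oddPow x m := by simp [oddPow]

lemma oddPow_one (x : F) : oddPow x 1 = x - x⁻¹ := by simp [oddPow]

/-- The matrix with entries `x_i ^ ν_j - x_i ^ (-ν_j)`. -/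
def altMatrix (x : Fin n → F) (ν : Weight n) : Matrix (Fin n) (Fin n) F :=
  Matrix.of fun i j => oddPow (x i) (ν j)

/-- The alternant `∑ w, sgn w · x ^ (w ν)` over the Weyl group of type `C_n`, as a determinant. -/
def alternant (x : Fin n → F) (ν : Weight n) : F := (altMatrix x ν).det

/-- The half sum of the positive roots. -/
def rho (n : ℕ) : Weight n := fun j => (n : ℤ) - j

/-- The Weyl denominator of type `C_n`. -/
def weylDenom (x : Fin n → F) : F :=
  (∏ i, (x i - (x i)⁻¹)) *
    ∏ i, ∏ j ∈ Finset.Ioi i, (x i + (x i)⁻¹ - (x j + (x j)⁻¹))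

open Polynomial in
lemma isMonicOfDegree_chebyshev_S (R : Type*) [CommRing R] [Nontrivial R] (m : ℕ) :
    (Chebyshev.S R m).IsMonicOfDegree m := by
  induction m using Nat.twoStepInduction with
  | zero => simp
  | one => simpa using isMonicOfDegree_X R
  | more m ih₀ ih₁ =>
    have hS : Chebyshev.S R (m + 2 : ℕ) = X * Chebyshev.S R (m + 1 : ℕ) - Chebyshev.S R m := by
      exact_mod_cast Chebyshev.S_add_two R m
    have hdeg : (X * Chebyshev.S R (m + 1 : ℕ)).IsMonicOfDegree (m + 2) := by
      convert (isMonicOfDegree_X R).mul ih₁ using 1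
      lia
    rw [hS]
    refine hdeg.sub ?_
    rw [ih₀.natDegree_eq]
    lia

lemma oddPow_add_two {x : F} (hx : x ≠ 0) (m : ℤ) :
    oddPow x (m + 2) = (x + x⁻¹) * oddPow x (m + 1) - oddPow x m := by
  simp only [oddPow, neg_add, zpow_add₀ hx, zpow_neg, zpow_ofNat]
  field_simp
  ring

open Polynomial in
lemma oddPow_eq_mul_eval_chebyshev_S {x : F} (hx : x ≠ 0) (m : ℕ) :
    oddPow x (m + 1) = oddPow x 1 * (Chebyshev.S F m).eval (x + x⁻¹) := by
  induction m using Nat.twoStepInduction with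
  | zero => simp
  | one =>
    have h := oddPow_add_two hx 0
    norm_num at h ⊢
    rw [h, mul_comm]
  | more m ih₀ ih₁ =>
    push_cast at ih₁ ⊢
    rw [Chebyshev.S_add_two, eval_sub, eval_mul, eval_X, mul_sub, ← ih₀, mul_left_comm, ← ih₁,
      ← oddPow_add_two hx]
    ring_nf

lemma prod_Ioi_rev {M : Type*} [CommMonoid M] (f : Fin n → Fin n → M) :
    ∏ i : Fin n, ∏ j ∈ Finset.Ioi i, f j.rev i.rev = ∏ i : Fin n, ∏ j ∈ Finset.Ioi i, f i j := by
  rw [Finset.prod_sigma', Finset.prod_sigma']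
  refine Finset.prod_bij' (fun p _ => ⟨p.2.rev, p.1.rev⟩) (fun p _ => ⟨p.2.rev, p.1.rev⟩)
    ?_ ?_ ?_ ?_ ?_ <;> simp

-- Dividing row `i` of the alternant by `x_i - x_i⁻¹` leaves monic polynomials of degrees
-- `n - 1, …, 0` in `x_i + x_i⁻¹`, hence a Vandermonde determinant with its columns reversed.
theorem weylDenom_eq_alternant (x : Fin n → F) (hx : ∀ i, x i ≠ 0) :
    weylDenom x = alternant x (rho n) := by
  have vandermonde := Matrix.det_eval_matrixOfPolynomials_eq_det_vandermonde
    (fun i : Fin n => x i.rev + (x i.rev)⁻¹) (fun j => Polynomial.Chebyshev.S F (j : ℕ))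
    (fun j => (isMonicOfDegree_chebyshev_S F j).natDegree_eq)
    (fun j => (isMonicOfDegree_chebyshev_S F j).monic)
  rw [Matrix.det_vandermonde,
    prod_Ioi_rev fun i j => x i + (x i)⁻¹ - (x j + (x j)⁻¹)] at vandermonde
  rw [weylDenom, vandermonde, alternant,
    ← Matrix.det_submatrix_equiv_self Fin.revPerm (altMatrix x _),
    ← Equiv.prod_comp Fin.revPerm, ← Matrix.det_mul_column]
  congr 1
  ext i j
  have hj : rho n j.rev = ((j : ℕ) : ℤ) + 1 := by
    have := j.2
    simp only [rho, Fin.val_rev]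
    lia
  simp only [Matrix.of_apply, altMatrix, Matrix.submatrix_apply, Fin.revPerm_apply, hj,
    oddPow_eq_mul_eval_chebyshev_S (hx _), oddPow_one]

lemma weylDenom_comp_perm (x : Fin n → F) (σ : Equiv.Perm (Fin n)) :
    weylDenom (x ∘ σ) = (σ.sign : ℤ) * weylDenom x := by
  have hanti := σ.prod_Ioi_comp_eq_sign_mul_prod
    (f := fun i j => x i + (x i)⁻¹ - (x j + (x j)⁻¹)) fun _ _ => (neg_sub _ _).symm
  simp only [weylDenom, Function.comp_apply, hanti, Equiv.prod_comp σ fun i => x i - (x i)⁻¹]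
  ring

lemma weylDenom_cons (t : F) (y : Fin n → F) :
    weylDenom (Fin.cons t y : Fin (n + 1) → F) =
      (t - t⁻¹) * (∏ j, (t + t⁻¹ - (y j + (y j)⁻¹))) * weylDenom y := by
  simp only [weylDenom, Fin.prod_univ_succ, Fin.prod_Ioi_zero, Fin.prod_Ioi_succ, Fin.cons_zero,
    Fin.cons_succ]
  ring

/-- The part of the Weyl denominator that involves the `i`-th variable, as a function of the value
`t` of that variable. -/
def denomFactor (x : Fin n → F) (i : Fin n) (t : F) : F :=
  (t - t⁻¹) * ∏ j ∈ Finset.univ.erase i, (t + t⁻¹ - (x j + (x j)⁻¹))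

lemma denomFactor_inv (x : Fin n → F) (i : Fin n) (t : F) :
    denomFactor x i t⁻¹ = -denomFactor x i t := by
  simp only [denomFactor, inv_inv, add_comm t⁻¹ t]
  ring

lemma weylDenom_update (x : Fin (n + 1) → F) (i : Fin (n + 1)) (t : F) :
    weylDenom (Function.update x i t) =
      (-1) ^ (i : ℕ) * (denomFactor x i t * weylDenom (i.removeNth x)) := by
  have hcons : (Function.update x i t) ∘ i.cycleRange.symm = Fin.cons t (i.removeNth x) := by
    rw [← Fin.insertNth_removeNth, Fin.insertNth_comp_cycleRange_symm]
  have hsplit : ∏ j ∈ Finset.univ.erase i, (t + t⁻¹ - (x j + (x j)⁻¹)) =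
      ∏ j, (t + t⁻¹ - (i.removeNth x j + (i.removeNth x j)⁻¹)) := by
    rw [← Finset.compl_singleton, ← Fin.image_succAbove_univ,
      Finset.prod_image fun _ _ _ _ h => Fin.succAbove_right_injective h]
    rfl
  rw [denomFactor, hsplit, ← weylDenom_cons, ← hcons, weylDenom_comp_perm, Equiv.Perm.sign_symm,
    Fin.sign_cycleRange, ← mul_assoc]
  push_cast
  rw [← mul_pow, neg_one_mul, neg_neg, one_pow, one_mul]

lemma weylDenom_update_mul_denomFactor (x : Fin n → F) (i : Fin n) (s t : F) :
    weylDenom (Function.update x i s) * denomFactor x i t =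
      weylDenom (Function.update x i t) * denomFactor x i s := by
  obtain _ | n := n
  · exact i.elim0
  · rw [weylDenom_update, weylDenom_update]
    ring

lemma denomFactor_ne_zero {x : Fin n → F} {i : Fin n} {t : F}
    (h : weylDenom (Function.update x i t) ≠ 0) : denomFactor x i t ≠ 0 := by
  obtain _ | n := n
  · exact i.elim0
  · rw [weylDenom_update] at h
    exact left_ne_zero_of_mul (right_ne_zero_of_mul h)

lemma weylDenom_update_inv (x : Fin n → F) (i : Fin n) (t : F) :
    weylDenom (Function.update x i t⁻¹) = -weylDenom (Function.update x i t) := by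
  obtain _ | n := n
  · exact i.elim0
  · rw [weylDenom_update, weylDenom_update, denomFactor_inv]
    ring

lemma alternant_comp_perm (x : Fin n → F) (ν : Weight n) (σ : Equiv.Perm (Fin n)) :
    alternant x (ν ∘ σ) = (σ.sign : ℤ) * alternant x ν :=
  Matrix.det_permute' σ (altMatrix x ν)

lemma alternant_update_left (x : Fin n → F) (ν : Weight n) (i : Fin n) (t : F) :
    alternant (Function.update x i t) ν =
      ((altMatrix x ν).updateRow i fun j => oddPow t (ν j)).det := by
  rw [alternant]
  congr 1
  ext a b
  rcases eq_or_ne a i with rfl | h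
  · simp [altMatrix]
  · simp [altMatrix, h]

lemma alternant_update_right (x : Fin n → F) (ν : Weight n) (j : Fin n) (m : ℤ) :
    alternant x (Function.update ν j m) =
      ((altMatrix x ν).updateCol j fun i => oddPow (x i) m).det := by
  rw [alternant]
  congr 1
  ext a b
  rcases eq_or_ne b j with rfl | h
  · simp [altMatrix]
  · simp [altMatrix, h]

lemma alternant_update_neg (x : Fin n → F) (ν : Weight n) (j : Fin n) (m : ℤ) :
    alternant x (Function.update ν j (-m)) = -alternant x (Function.update ν j m) := by
  have hneg : (fun i => oddPow (x i) (-m)) = (-1 : F) • fun i => oddPow (x i) m := by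
    ext i
    simp
  rw [alternant_update_right, alternant_update_right, hneg, Matrix.det_updateCol_smul, neg_one_mul]

lemma alternant_eq_zero_of_eq (x : Fin n → F) (ν : Weight n) {i j : Fin n} (hij : i ≠ j)
    (h : ν i = ν j) : alternant x ν = 0 :=
  Matrix.det_zero_of_column_eq hij fun a => by simp [altMatrix, h]

lemma alternant_eq_zero_of_eq_zero (x : Fin n → F) (ν : Weight n) {j : Fin n} (h : ν j = 0) :
    alternant x ν = 0 :=
  Matrix.det_eq_zero_of_column_eq_zero j fun a => by simp [altMatrix, h]

end Alternant

/-! ### The product of `G_{n,k}` with the Weyl denominator -/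

section WeylDenomMulG

variable {F : Type} [Field F] {n : ℕ}

/-- The variable `x_a` of the signed index `a`, with `x_{-i} = x_i⁻¹`. -/
def signedVar (x : Fin n → F) (a : Idx n) : F := x a.1 ^ (a.2 : ℤ)

lemma signedVar_one (x : Fin n → F) (i : Fin n) : signedVar x (i, 1) = x i := by
  simp [signedVar]

lemma signedVar_neg_one (x : Fin n → F) (i : Fin n) : signedVar x (i, -1) = (x i)⁻¹ := by
  simp [signedVar]

lemma prod_sdiff_opp {M : Type*} [CommMonoid M] (f : Idx n → M) (a : Idx n) :
    ∏ b ∈ Finset.univ \ {a, a.opp}, f b =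
      ∏ j ∈ Finset.univ.erase a.1, f (j, 1) * f (j, -1) := by
  have hprod : (Finset.univ \ {a, a.opp} : Finset (Idx n)) =
      Finset.univ.erase a.1 ×ˢ (Finset.univ : Finset ℤˣ) := by
    obtain ⟨i, s⟩ := a
    ext ⟨j, t⟩
    rcases Int.units_eq_one_or s with rfl | rfl <;> rcases Int.units_eq_one_or t with rfl | rfl <;>
      simp [Idx.opp]
  rw [hprod, Finset.prod_product]
  refine Finset.prod_congr rfl fun j _ => ?_
  rw [UnitsInt.univ, Finset.prod_pair (by decide)]

lemma mul_sub_mul_mul_sub_mul_inv {c d y z : F} (hcd : c * d = 1) (hy : y ≠ 0) (hz : z ≠ 0) :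
    (c * y - d * z) * (c * y - d * z⁻¹) = y * (c ^ 2 * y + (c ^ 2 * y)⁻¹ - (z + z⁻¹)) := by
  obtain rfl := eq_inv_of_mul_eq_one_right hcd
  have hc : c ≠ 0 := left_ne_zero_of_mul_eq_one hcd
  field_simp
  ring

-- The factors of `P_{n,a}` at `b` and `-b` combine to a quotient of two factors of `denomFactor`.
lemma mul_P_eq_denomFactor_div (x : Fin n → F) (hx : ∀ i, x i ≠ 0) {q : F} (hq : q ≠ 0)
    (a : Idx n) :
    (q ^ 2 * signedVar x a - (q ^ 2)⁻¹ * (signedVar x a)⁻¹) /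
        (signedVar x a - (signedVar x a)⁻¹) * P n q (signedVar x) a =
      denomFactor x a.1 (q ^ 2 * signedVar x a) / denomFactor x a.1 (signedVar x a) := by
  have hy : signedVar x a ≠ 0 := zpow_ne_zero _ (hx _)
  rw [P, prod_sdiff_opp, denomFactor, denomFactor, ← mul_inv, mul_div_mul_comm,
    ← Finset.prod_div_distrib]
  congr 1
  refine Finset.prod_congr rfl fun j _ => ?_
  have hden := mul_sub_mul_mul_sub_mul_inv (one_mul (1 : F)) hy (hx j)
  simp only [one_mul, one_pow] at hden
  rw [signedVar_one, signedVar_neg_one, div_mul_div_comm,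
    mul_sub_mul_mul_sub_mul_inv (mul_inv_cancel₀ hq) hy (hx j), hden, mul_div_mul_left _ _ hy]

lemma weylDenom_update_signedVar (x : Fin n → F) (a : Idx n) :
    weylDenom (Function.update x a.1 (signedVar x a)) = (a.2 : ℤ) * weylDenom x := by
  obtain ⟨i, s⟩ := a
  rcases Int.units_eq_one_or s with rfl | rfl
  · rw [signedVar_one, Function.update_eq_self]
    simp
  · rw [signedVar_neg_one, weylDenom_update_inv, Function.update_eq_self]
    simp

lemma weylDenom_mul_mul_P (x : Fin n → F) (hx : ∀ i, x i ≠ 0) (hD : weylDenom x ≠ 0) {q : F}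
    (hq : q ≠ 0) (a : Idx n) :
    weylDenom x * ((q ^ 2 * signedVar x a - (q ^ 2)⁻¹ * (signedVar x a)⁻¹) /
        (signedVar x a - (signedVar x a)⁻¹) * P n q (signedVar x) a) =
      (a.2 : ℤ) * weylDenom (Function.update x a.1 (q ^ 2 * signedVar x a)) := by
  have hsign : ((a.2 : ℤ) : F) * (a.2 : ℤ) = 1 := by
    exact_mod_cast congrArg (Int.cast (R := F)) (Int.units_coe_mul_self a.2)
  have hfactor : denomFactor x a.1 (signedVar x a) ≠ 0 := by
    refine denomFactor_ne_zero ?_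
    rw [weylDenom_update_signedVar]
    exact mul_ne_zero (left_ne_zero_of_mul_eq_one hsign) hD
  rw [mul_P_eq_denomFactor_div x hx hq, mul_div_assoc', div_eq_iff hfactor, mul_assoc,
    weylDenom_update_mul_denomFactor, weylDenom_update_signedVar, ← mul_assoc, ← mul_assoc, hsign,
    one_mul]

lemma pow_mul_oddPow_sub {x c : F} (hx : x ≠ 0) (hc : c ≠ 0) (k : ℕ) (m : ℤ) :
    x ^ k * oddPow (c * x) m - (x⁻¹) ^ k * oddPow (c * x⁻¹) m =
      c ^ m * oddPow x (m + k) + c ^ (-m) * oddPow x (m - k) := by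
  simp only [oddPow, mul_zpow, inv_zpow, inv_pow, sub_eq_add_neg, neg_add, neg_neg, zpow_add₀ hx,
    zpow_neg, zpow_natCast]
  have := zpow_ne_zero m hx
  have := zpow_ne_zero m hc
  field_simp
  ring

lemma sum_det_updateRow_eq_sum_det_updateCol {m R : Type*} [Fintype m] [DecidableEq m]
    [CommRing R] (A B : Matrix m m R) :
    ∑ i, (A.updateRow i (B i)).det = ∑ j, (A.updateCol j fun i => B i j).det := by
  have hrow (i : m) : (A.updateRow i (B i)).det = ∑ j, A.adjugate j i * B i j := by
    rw [← Matrix.cramer_transpose_apply, Matrix.cramer_eq_adjugate_mulVec,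
      ← Matrix.adjugate_transpose]
    rfl
  have hcol (j : m) : (A.updateCol j fun i => B i j).det = ∑ i, A.adjugate j i * B i j := by
    rw [← Matrix.cramer_apply, Matrix.cramer_eq_adjugate_mulVec]
    rfl
  simp only [hrow, hcol]
  exact Finset.sum_comm

/-- The matrix whose `i`-th row replaces that of `altMatrix x (rho n)` in the product of the Weyl
denominator with the summands of `G_{n,k}` at `± i`; here `c` stands for `q²`. -/
def shiftMatrix (x : Fin n → F) (c : F) (k : ℕ) : Matrix (Fin n) (Fin n) F :=
  Matrix.of fun i j => c ^ rho n j * oddPow (x i) (rho n j + k) +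
    c ^ (-rho n j) * oddPow (x i) (rho n j - k)

lemma sum_pow_mul_weylDenom_update (x : Fin n → F) (hx : ∀ i, x i ≠ 0) {c : F} (hc : c ≠ 0)
    (k : ℕ) (i : Fin n) :
    ∑ s : ℤˣ, signedVar x (i, s) ^ k *
        ((s : ℤ) * weylDenom (Function.update x i (c * signedVar x (i, s)))) =
      ((altMatrix x (rho n)).updateRow i (shiftMatrix x c k i)).det := by
  have hupdate {t : F} (ht : t ≠ 0) : weylDenom (Function.update x i t) =
      ((altMatrix x (rho n)).updateRow i fun j => oddPow t (rho n j)).det := by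
    rw [weylDenom_eq_alternant, alternant_update_left]
    intro a
    rcases eq_or_ne a i with rfl | h
    · simpa using ht
    · simpa [h] using hx a
  have hshift : shiftMatrix x c k i = (x i ^ k • fun j => oddPow (c * x i) (rho n j)) +
      -(x i)⁻¹ ^ k • fun j => oddPow (c * (x i)⁻¹) (rho n j) := by
    ext j
    simp only [shiftMatrix, Matrix.of_apply, Pi.add_apply, Pi.smul_apply, smul_eq_mul]
    rw [← pow_mul_oddPow_sub (hx i) hc]
    ring
  rw [hshift, Matrix.det_updateRow_add, Matrix.det_updateRow_smul, Matrix.det_updateRow_smul,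
    ← hupdate (mul_ne_zero hc (hx i)), ← hupdate (mul_ne_zero hc (inv_ne_zero (hx i))),
    UnitsInt.univ, Finset.sum_pair (by decide), signedVar_one, signedVar_neg_one]
  push_cast
  ring

theorem weylDenom_mul_G (x : Fin n → F) (hx : ∀ i, x i ≠ 0) (hD : weylDenom x ≠ 0) {q : F}
    (hq : q ≠ 0) (k : ℕ) :
    weylDenom x * G n k q (signedVar x) =
      ∑ j, (q ^ (2 * rho n j) * alternant x (Function.update (rho n) j (rho n j + k)) +
        q ^ (-(2 * rho n j)) * alternant x (Function.update (rho n) j (rho n j - k))) := by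
  calc weylDenom x * G n k q (signedVar x)
      = ∑ i, ∑ s : ℤˣ, signedVar x (i, s) ^ k *
          ((s : ℤ) * weylDenom (Function.update x i (q ^ 2 * signedVar x (i, s)))) := by
        rw [G, Fintype.sum_prod_type, Finset.mul_sum]
        refine Finset.sum_congr rfl fun i _ => ?_
        rw [Finset.mul_sum]
        refine Finset.sum_congr rfl fun s _ => ?_
        rw [← weylDenom_mul_mul_P x hx hD hq (i, s)]
        ring
    _ = ∑ j, ((altMatrix x (rho n)).updateCol j fun i => shiftMatrix x (q ^ 2) k i j).det := by
        simp only [sum_pow_mul_weylDenom_update x hx (pow_ne_zero 2 hq)]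
        exact sum_det_updateRow_eq_sum_det_updateCol _ _
    _ = _ := by
        refine Finset.sum_congr rfl fun j _ => ?_
        have hcol : (fun i => shiftMatrix x (q ^ 2) k i j) =
            (q ^ (2 * rho n j) • fun i => oddPow (x i) (rho n j + k)) +
              q ^ (-(2 * rho n j)) • fun i => oddPow (x i) (rho n j - k) := by
          ext i
          simp [shiftMatrix, zpow_mul]
        rw [hcol, Matrix.det_updateCol_add, Matrix.det_updateCol_smul, Matrix.det_updateCol_smul,
          ← alternant_update_right, ← alternant_update_right]

end WeylDenomMulG

/-! ### Straightening the alternants of hook weights -/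

section Straightening

variable {F : Type*} [Field F] {n : ℕ}

lemma rbar_of_lt {r : ℕ} (h : r < n) : rbar n r = r := by simp only [rbar]; lia

lemma rbar_two_mul_sub {j : ℕ} (h : j < n) : rbar n (2 * n - j) = j := by simp only [rbar]; lia

lemma update_rho_eq_hookWeight_add_rho_comp (j : Fin n) (k r : ℕ) (hr : rbar n r = j) :
    Function.update (rho n) j ((n : ℤ) + k - r) = (hookWeight n k r + rho n) ∘ j.cycleRange := by
  have : NeZero n := ⟨j.pos.ne'⟩
  ext i
  simp only [Function.comp_apply, Pi.add_apply, hookWeight, rho, hr]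
  rcases lt_trichotomy i j with h | rfl | h
  · have : (i : ℕ) < j := h
    rw [Function.update_of_ne h.ne, Fin.coe_cycleRange_of_lt h, if_neg (by lia), if_pos (by lia)]
    simp only [rho]
    push_cast
    ring
  · rw [Function.update_self, Fin.cycleRange_self]
    simp only [Fin.coe_ofNat_eq_mod, Nat.zero_mod, ↓reduceIte, Nat.cast_zero, sub_zero]
    ring
  · have : (j : ℕ) < i := h
    rw [Function.update_of_ne h.ne', Fin.cycleRange_of_gt h, if_neg (by lia), if_neg (by lia)]
    simp [rho]

lemma alternant_update_rho_eq_hook (x : Fin n → F) (j : Fin n) (k r : ℕ) (hr : rbar n r = j) :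
    alternant x (Function.update (rho n) j ((n : ℤ) + k - r)) =
      (-1) ^ (j : ℕ) * alternant x (hookWeight n k r + rho n) := by
  rw [update_rho_eq_hookWeight_add_rho_comp j k r hr, alternant_comp_perm, Fin.sign_cycleRange]
  push_cast
  rfl

lemma alternant_rho_add_hook (x : Fin n → F) (j : Fin n) (k : ℕ) :
    alternant x (Function.update (rho n) j (rho n j + k)) =
      (-1) ^ (j : ℕ) * alternant x (hookWeight n k j + rho n) := by
  rw [← alternant_update_rho_eq_hook x j k j (rbar_of_lt j.2)]
  congr 2
  simp only [rho]
  ring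

lemma alternant_rho_sub_hook (x : Fin n → F) (j : Fin n) (k : ℕ) :
    alternant x (Function.update (rho n) j (rho n j - k)) =
      -((-1) ^ (j : ℕ) * alternant x (hookWeight n k (2 * n - j) + rho n)) := by
  rw [← alternant_update_rho_eq_hook x j k _ (rbar_two_mul_sub j.2), ← alternant_update_neg]
  have := j.2
  congr 2
  simp only [rho]
  lia

-- The entries of `rho` exhaust `1, …, n`, so such an `m` is `0` or repeats an entry up to sign.
lemma alternant_update_rho_eq_zero (x : Fin n → F) (j : Fin n) {m : ℤ} (hm : |m| ≤ n)
    (hne : |m| ≠ rho n j) : alternant x (Function.update (rho n) j m) = 0 := by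
  rcases eq_or_ne m 0 with rfl | h0
  · exact alternant_eq_zero_of_eq_zero x _ (Function.update_self ..)
  have hpos : 0 < |m| := abs_pos.2 h0
  have habs : alternant x (Function.update (rho n) j |m|) = 0 := by
    lift |m| to ℕ using abs_nonneg m with l
    have hrho : rho n ⟨n - l, by lia⟩ = l := by simp only [rho]; lia
    have hj : (⟨n - l, by lia⟩ : Fin n) ≠ j := fun h => hne (by rw [← h, hrho])
    refine alternant_eq_zero_of_eq x _ hj ?_
    rw [Function.update_of_ne hj, Function.update_self, hrho]
  rcases abs_choice m with h | h
  · rwa [h] at habs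
  · rwa [h, alternant_update_neg, neg_eq_zero] at habs

lemma alternant_rho_add_eq_zero (x : Fin n → F) (j : Fin n) {k : ℕ} (hk : 1 ≤ k) (hkj : k ≤ j) :
    alternant x (Function.update (rho n) j (rho n j + k)) = 0 := by
  have := j.2
  have := abs_cases (rho n j + k)
  apply alternant_update_rho_eq_zero <;> simp only [rho] at * <;> lia

lemma alternant_rho_sub_eq_zero (x : Fin n → F) (j : Fin n) {k : ℕ} (hk : 1 ≤ k)
    (hkj : k ≤ 2 * n - j) (hne : k ≠ 2 * (n - j)) :
    alternant x (Function.update (rho n) j (rho n j - k)) = 0 := by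
  have := j.2
  have := abs_cases (rho n j - k)
  apply alternant_update_rho_eq_zero <;> simp only [rho] at * <;> lia

lemma alternant_rho_sub_eq_neg (x : Fin n → F) (j : Fin n) :
    alternant x (Function.update (rho n) j (rho n j - (2 * (n - j) : ℕ))) =
      -alternant x (rho n) := by
  have hreflect : rho n j - (2 * (n - j) : ℕ) = -rho n j := by
    have := j.2
    simp only [rho]
    lia
  rw [hreflect, alternant_update_neg, Function.update_eq_self]

end Straightening

/-! ### Root vectors of `𝔰𝔭_{2n}(ℂ)` -/

section RootVectors

open Matrix

variable {n : ℕ}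

/-- The weight `± ε_i` of a basis vector of `ℂ^{2n}`. -/
def wt (a : Fin n ⊕ Fin n) : Weight n := Sum.elim eps (fun i => -eps i) a

/-- The coordinate `± μ_i` of a weight at a signed index. -/
def coord (μ : Weight n) (a : Fin n ⊕ Fin n) : ℤ := Sum.elim μ (fun i => -μ i) a

lemma mem_sp_iff (A : Matrix (Fin n ⊕ Fin n) (Fin n ⊕ Fin n) ℂ) :
    A ∈ Sp n ↔ Aᵀ * J (Fin n) ℂ = -(J (Fin n) ℂ * A) := by
  rw [Sp, LieAlgebra.Symplectic.sp, mem_skewAdjointMatricesLieSubalgebra,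
    mem_skewAdjointMatricesSubmodule, Matrix.IsSkewAdjoint, Matrix.IsAdjointPair, mul_neg]

lemma J_mul_J_mul (A : Matrix (Fin n ⊕ Fin n) (Fin n ⊕ Fin n) ℂ) :
    J (Fin n) ℂ * (J (Fin n) ℂ * A) = -A := by
  rw [← Matrix.mul_assoc, J_squared, Matrix.neg_mul, Matrix.one_mul]

lemma transpose_mul_J (y : Sp n) : y.1ᵀ * J (Fin n) ℂ = -(J (Fin n) ℂ * y.1) :=
  (mem_sp_iff _).1 y.2

lemma J_mul_transpose (y : Sp n) : J (Fin n) ℂ * y.1ᵀ = -(y.1 * J (Fin n) ℂ) := by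
  calc J (Fin n) ℂ * y.1ᵀ
      = -(J (Fin n) ℂ * (y.1ᵀ * J (Fin n) ℂ) * J (Fin n) ℂ) := by
        rw [Matrix.mul_assoc, Matrix.mul_assoc, J_squared]
        simp
    _ = -(y.1 * J (Fin n) ℂ) := by rw [transpose_mul_J, Matrix.mul_neg, J_mul_J_mul, neg_neg]

/-- The equivariant projection `X ↦ X + J Xᵀ J` of `𝔤𝔩_{2n}` onto `𝔰𝔭_{2n}`; on `𝔰𝔭_{2n}` it is
multiplication by `2`. -/
def spProj : Matrix (Fin n ⊕ Fin n) (Fin n ⊕ Fin n) ℂ →ₗ[ℂ] Sp n where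
  toFun X := ⟨X + J (Fin n) ℂ * Xᵀ * J (Fin n) ℂ, by
    rw [mem_sp_iff]
    simp only [transpose_add, transpose_mul, transpose_transpose, J_transpose, Matrix.add_mul,
      Matrix.mul_add, Matrix.neg_mul, Matrix.mul_neg, neg_neg, Matrix.mul_assoc, J_squared,
      J_mul_J_mul, Matrix.mul_one]
    abel⟩
  map_add' X Y := by
    ext1
    simp only [transpose_add, Matrix.mul_add, Matrix.add_mul, AddMemClass.mk_add_mk]
    abel
  map_smul' c X := by ext1; simp

lemma spProj_val (X : Matrix (Fin n ⊕ Fin n) (Fin n ⊕ Fin n) ℂ) :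
    (spProj X).1 = X + J (Fin n) ℂ * Xᵀ * J (Fin n) ℂ := rfl

lemma lie_spProj (y : Sp n) (X : Matrix (Fin n ⊕ Fin n) (Fin n ⊕ Fin n) ℂ) :
    ⁅y, spProj X⁆ = spProj ⁅y.1, X⁆ := by
  apply Subtype.ext
  have hleft : J (Fin n) ℂ * (y.1 * X)ᵀ * J (Fin n) ℂ =
      -(J (Fin n) ℂ * Xᵀ * J (Fin n) ℂ * y.1) := by
    rw [transpose_mul, Matrix.mul_assoc, Matrix.mul_assoc, transpose_mul_J]
    simp only [Matrix.mul_neg, Matrix.mul_assoc]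
  have hright : J (Fin n) ℂ * (X * y.1)ᵀ * J (Fin n) ℂ =
      -(y.1 * (J (Fin n) ℂ * Xᵀ * J (Fin n) ℂ)) := by
    rw [transpose_mul, ← Matrix.mul_assoc, J_mul_transpose]
    simp only [Matrix.neg_mul, Matrix.mul_assoc]
  rw [LieSubalgebra.coe_bracket, spProj_val, spProj_val, Ring.lie_def, Ring.lie_def, transpose_sub,
    Matrix.mul_sub, Matrix.sub_mul, hleft, hright]
  noncomm_ring

lemma spProj_coe (y : Sp n) : spProj y.1 = (2 : ℂ) • y := by
  apply Subtype.ext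
  rw [spProj_val, J_mul_transpose, Matrix.neg_mul, Matrix.mul_assoc, J_squared]
  simp [two_smul]

/-- The image in `𝔰𝔭_{2n}` of the matrix unit `E_{ab}`, a root vector if `a ≠ b`. -/
def rootVec (a b : Fin n ⊕ Fin n) : Sp n := spProj (Matrix.single a b 1)

lemma eq_sum_rootVec (y : Sp n) : y = (2 : ℂ)⁻¹ • ∑ a, ∑ b, y.1 a b • rootVec a b := by
  have hsum : ∑ a, ∑ b, y.1 a b • rootVec a b = spProj y.1 := by
    conv_rhs => rw [matrix_eq_sum_single y.1]
    simp only [map_sum, rootVec, ← map_smul, smul_single, smul_eq_mul, mul_one]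
  rw [hsum, spProj_coe, inv_smul_smul₀ two_ne_zero]

lemma cartan_val (h : Fin n → ℂ) :
    (cartan h : Matrix (Fin n ⊕ Fin n) (Fin n ⊕ Fin n) ℂ) =
      diagonal (Sum.elim h (fun i => -h i)) := by
  rw [cartan, ← fromBlocks_diagonal]
  ext i j; by_cases hij : i = j <;> simp [hij]

lemma evalWeight_wt (a : Fin n ⊕ Fin n) (h : Fin n → ℂ) :
    evalWeight (wt a) h = Sum.elim h (fun i => -h i) a := by
  rcases a with i | i <;>
    simp [evalWeight, wt, eps, Pi.single_apply]

lemma evalWeight_add (μ ν : Weight n) (h : Fin n → ℂ) :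
    evalWeight (μ + ν) h = evalWeight μ h + evalWeight ν h := by
  simp [evalWeight, add_mul, Finset.sum_add_distrib]

lemma evalWeight_zero (h : Fin n → ℂ) : evalWeight (0 : Weight n) h = 0 := by
  simp [evalWeight]

lemma evalWeight_neg (μ : Weight n) (h : Fin n → ℂ) : evalWeight (-μ) h = -evalWeight μ h := by
  simp [evalWeight]

lemma evalWeight_sub (μ ν : Weight n) (h : Fin n → ℂ) :
    evalWeight (μ - ν) h = evalWeight μ h - evalWeight ν h := by
  simp [evalWeight, sub_mul, Finset.sum_sub_distrib]

lemma evalWeight_intCast (μ ν : Weight n) :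
    evalWeight μ (fun i => (ν i : ℂ)) = ((∑ i, μ i * ν i : ℤ) : ℂ) := by
  simp [evalWeight]

lemma sum_mul_wt (μ : Weight n) (a : Fin n ⊕ Fin n) : ∑ i, μ i * wt a i = coord μ a := by
  rcases a with i | i <;> simp [wt, eps, coord, Pi.single_apply]

lemma lie_cartan_rootVec (h : Fin n → ℂ) (a b : Fin n ⊕ Fin n) :
    ⁅cartan h, rootVec a b⁆ = evalWeight (wt a - wt b) h • rootVec a b := by
  rw [rootVec, lie_spProj, cartan_val, ← map_smul, evalWeight_sub, evalWeight_wt, evalWeight_wt,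
    Ring.lie_def]
  refine congrArg spProj (Matrix.ext fun c d => ?_)
  simp only [Matrix.sub_apply, diagonal_mul, mul_diagonal, Matrix.smul_apply, smul_eq_mul,
    single_apply]
  split_ifs with hcd
  · rw [hcd.1, hcd.2]
    ring
  · simp

lemma J_apply_eq_zero {a b : Fin n ⊕ Fin n} (h : b ≠ a.swap) : J (Fin n) ℂ a b = 0 := by
  rcases a with i | i <;> rcases b with j | j <;> simp_all [J, one_apply, eq_comm]

lemma J_mul_single_mul_J (a b : Fin n ⊕ Fin n) :
    J (Fin n) ℂ * Matrix.single b a 1 * J (Fin n) ℂ =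
      Matrix.single b.swap a.swap (J (Fin n) ℂ b.swap b * J (Fin n) ℂ a a.swap) := by
  ext c d
  have hentry : (J (Fin n) ℂ * Matrix.single b a 1 * J (Fin n) ℂ : Matrix _ _ ℂ) c d =
      J (Fin n) ℂ c b * J (Fin n) ℂ a d := by
    rw [Matrix.mul_assoc, mul_apply, Finset.sum_eq_single b]
    · rw [single_mul_apply_same, one_mul]
    · intro e _ he
      rw [single_mul_apply_of_ne _ _ _ _ _ he, mul_zero]
    · simp
  rw [hentry, single_apply]
  split_ifs with hcd
  · rw [← hcd.1, ← hcd.2]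
  · by_cases hd : d = a.swap
    · rw [J_apply_eq_zero (a := c), zero_mul]
      rintro rfl
      exact hcd ⟨Sum.swap_swap c, hd.symm⟩
    · rw [J_apply_eq_zero hd, mul_zero]

lemma rootVec_val (a b : Fin n ⊕ Fin n) :
    (rootVec a b).1 = Matrix.single a b 1 +
      Matrix.single b.swap a.swap (J (Fin n) ℂ b.swap b * J (Fin n) ℂ a a.swap) := by
  rw [rootVec, spProj_val, transpose_single, J_mul_single_mul_J]

lemma rootVec_self (a : Fin n ⊕ Fin n) : rootVec a a = cartan fun i => (wt a i : ℂ) := by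
  apply Subtype.ext
  rw [rootVec_val, cartan_val]
  ext c d
  rcases a with i | i <;> rcases c with c | c <;> rcases d with d | d <;>
    simp [J, single_apply, diagonal_apply, wt, eps, Pi.single_apply] <;> grind

/-- The factor `2` for the long roots and `1` for the short ones. -/
def longFactor (a b : Fin n ⊕ Fin n) : ℤ := if b = a.swap then 2 else 1

lemma lie_rootVec_rootVec {a b : Fin n ⊕ Fin n} (hab : a ≠ b) :
    ⁅rootVec a b, rootVec b a⁆ = (longFactor a b : ℂ) • (rootVec a a - rootVec b b) := by
  conv_lhs => rw [rootVec.eq_def b a, lie_spProj, rootVec_val, Ring.lie_def]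
  rw [rootVec, rootVec, ← map_sub, ← map_smul]
  congr 1
  rw [Matrix.add_mul, Matrix.mul_add, single_mul_single_same, single_mul_single_same]
  by_cases hlong : b = a.swap
  · subst hlong
    have hJ : J (Fin n) ℂ a a.swap * J (Fin n) ℂ a a.swap = 1 := by
      rcases a with i | i <;> simp [J]
    simp only [longFactor, Sum.swap_swap, single_mul_single_same, mul_one, hJ, if_true]
    push_cast
    rw [two_smul]
    abel
  · have hshort : a ≠ b.swap := by rintro rfl; exact hlong b.swap_swap.symm
    rw [single_mul_single_of_ne _ _ _ _ (Ne.symm hlong), single_mul_single_of_ne _ _ _ _ hshort]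
    simp [longFactor, hlong]

-- The invariance of `∑ E_{ab} ⊗ E_{ba}` under the adjoint action.
lemma sum_bilin_lie_single {R m E : Type*} [CommRing R] [Fintype m] [DecidableEq m]
    [AddCommGroup E] [Module R E] (B : Matrix m m R →ₗ[R] Matrix m m R →ₗ[R] E)
    (Y : Matrix m m R) :
    ∑ a, ∑ b, (B ⁅Y, Matrix.single a b 1⁆ (Matrix.single b a 1) +
      B (Matrix.single a b 1) ⁅Y, Matrix.single b a 1⁆) = 0 := by
  have hmul (a b : m) : Y * Matrix.single a b 1 = ∑ c, Y c a • Matrix.single c b (1 : R) := by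
    ext i j
    simp [Matrix.sum_apply, single_apply, mul_apply, ite_and]
  have hmul' (a b : m) : Matrix.single a b 1 * Y = ∑ c, Y b c • Matrix.single a c (1 : R) := by
    ext i j
    simp [Matrix.sum_apply, single_apply, mul_apply, ite_and]
  have hswap_left : ∑ a, ∑ b, ∑ c, Y c a • B (Matrix.single c b 1) (Matrix.single b a 1) =
      ∑ a, ∑ b, ∑ c, Y a c • B (Matrix.single a b 1) (Matrix.single b c 1) := by
    rw [Finset.sum_comm]
    conv_rhs => rw [Finset.sum_comm]
    exact Finset.sum_congr rfl fun b _ => Finset.sum_comm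
  have hswap_right : ∑ a, ∑ b, ∑ c, Y b c • B (Matrix.single a c 1) (Matrix.single b a 1) =
      ∑ a, ∑ b, ∑ c, Y c b • B (Matrix.single a b 1) (Matrix.single c a 1) :=
    Finset.sum_congr rfl fun a _ => Finset.sum_comm
  simp only [Ring.lie_def, hmul, hmul', map_sub, map_sum, map_smul, LinearMap.sub_apply,
    LinearMap.sum_apply, LinearMap.smul_apply, Finset.sum_add_distrib, Finset.sum_sub_distrib,
    hswap_left, hswap_right]
  abel

end RootVectors

/-! ### Weight spaces -/

section WeightSpaces

open Matrix

variable {n : ℕ} {V : Type} [AddCommGroup V] [Module ℂ V] [LieRingModule (Sp n) V]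
  [LieModule ℂ (Sp n) V]

lemma mem_weightSpace {μ : Weight n} {v : V} :
    v ∈ weightSpace V μ ↔ ∀ h : Fin n → ℂ, ⁅cartan h, v⁆ = evalWeight μ h • v := by
  simp [weightSpace, Submodule.mem_iInf]

lemma lie_mem_weightSpace {α : Weight n} {x : Sp n}
    (hx : ∀ h : Fin n → ℂ, ⁅cartan h, x⁆ = evalWeight α h • x) {μ : Weight n} {v : V}
    (hv : v ∈ weightSpace V μ) : ⁅x, v⁆ ∈ weightSpace V (μ + α) := by
  rw [mem_weightSpace] at hv ⊢
  intro h
  rw [leibniz_lie, hx, hv, lie_smul, smul_lie, evalWeight_add, add_smul, add_comm]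

lemma rootVec_lie_mem (a b : Fin n ⊕ Fin n) {μ : Weight n} {v : V} (hv : v ∈ weightSpace V μ) :
    ⁅rootVec a b, v⁆ ∈ weightSpace V (μ + (wt a - wt b)) :=
  lie_mem_weightSpace (fun h => lie_cartan_rootVec h a b) hv

lemma rootVec_self_lie (a : Fin n ⊕ Fin n) {μ : Weight n} {v : V} (hv : v ∈ weightSpace V μ) :
    ⁅rootVec a a, v⁆ = (coord μ a : ℂ) • v := by
  rw [rootVec_self, mem_weightSpace.1 hv, evalWeight_intCast, sum_mul_wt]

lemma evalWeight_injective : Function.Injective fun (μ : Weight n) h => evalWeight μ h := by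
  intro μ ν h
  ext i
  simpa [evalWeight, eps, Pi.single_apply] using congrFun h fun j => (eps i j : ℂ)

lemma cartan_lie_cartan (h h' : Fin n → ℂ) : ⁅cartan h, cartan h'⁆ = 0 := by
  apply Subtype.ext
  rw [LieSubalgebra.coe_bracket, Ring.lie_def, cartan_val, cartan_val, diagonal_mul_diagonal,
    diagonal_mul_diagonal]
  simp [mul_comm]

variable (V) in
lemma iSupIndep_weightSpace : iSupIndep fun μ : Weight n => weightSpace V μ := by
  have h := Module.End.independent_iInf_maxGenEigenspace_of_forall_mapsTo
    (fun h : Fin n → ℂ => LieModule.toEnd ℂ (Sp n) V (cartan h)) (fun h h' φ =>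
      Module.End.mapsTo_maxGenEigenspace_of_comm (by
        rw [commute_iff_lie_eq, ← LieHom.map_lie, cartan_lie_cartan, map_zero]) φ)
  refine (h.comp evalWeight_injective).mono fun μ => ?_
  exact iInf_mono fun i => Module.End.genEigenspace_le_maximal _ _ 1

variable (V) in
/-- The multiplicity of a weight. -/
def mult (μ : Weight n) : ℕ := Module.finrank ℂ (weightSpace V μ)

variable (V) in
lemma finite_support_mult [FiniteDimensional ℂ V] :
    (Function.support (mult V (n := n))).Finite := by
  refine (WellFoundedGT.finite_ne_bot_of_iSupIndep (iSupIndep_weightSpace V)).subset ?_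
  intro μ hμ hbot
  exact hμ (by rw [mult, hbot, finrank_bot])

/-! ### Dominance -/

/-- A weight is dominant if its coordinates are weakly decreasing and nonnegative. -/
def IsDominant (s : Weight n) : Prop := Antitone s ∧ ∀ i, 0 ≤ s i

lemma dotProduct_nonneg_of_mem_positiveRoots {α s : Weight n} (hα : α ∈ positiveRoots n)
    (hs : IsDominant s) : 0 ≤ α ⬝ᵥ s := by
  rcases hα with ⟨i, j, hij, rfl | rfl⟩ | ⟨i, rfl⟩
  · simpa [eps, sub_dotProduct] using hs.1 hij.le
  · simpa [eps, add_dotProduct] using add_nonneg (hs.2 i) (hs.2 j)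
  · rw [smul_dotProduct]
    simpa [eps] using hs.2 i

lemma dotProduct_rho_pos {α : Weight n} (hα : α ∈ positiveRoots n) : 0 < α ⬝ᵥ rho n := by
  rcases hα with ⟨i, j, hij, rfl | rfl⟩ | ⟨i, rfl⟩
  · simpa [eps, sub_dotProduct, rho] using hij
  · have := i.2
    have := j.2
    simp only [eps, add_dotProduct, single_dotProduct, rho, one_mul]
    lia
  · have := i.2
    rw [smul_dotProduct]
    simp [eps, rho]

lemma eps_add_eps_mem_positiveRoots (i j : Fin n) : eps i + eps j ∈ positiveRoots n := by
  rcases lt_trichotomy i j with h | rfl | h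
  · exact .inl ⟨i, j, h, .inr rfl⟩
  · exact .inr ⟨i, (two_smul ℕ _).symm⟩
  · exact .inl ⟨j, i, h, .inr (add_comm _ _)⟩

lemma eps_sub_eps_mem_positiveRoots {i j : Fin n} (hij : i ≠ j) :
    eps i - eps j ∈ positiveRoots n ∨ eps j - eps i ∈ positiveRoots n :=
  hij.lt_or_gt.imp (fun h => .inl ⟨i, j, h, .inl rfl⟩) fun h => .inl ⟨j, i, h, .inl rfl⟩

lemma wt_sub_wt_mem_positiveRoots {a b : Fin n ⊕ Fin n} (hab : a ≠ b) :
    wt a - wt b ∈ positiveRoots n ∨ wt b - wt a ∈ positiveRoots n := by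
  rcases a with i | i <;> rcases b with j | j <;>
    simp only [wt, Sum.elim_inl, Sum.elim_inr, sub_neg_eq_add, neg_add_eq_sub]
  · exact eps_sub_eps_mem_positiveRoots fun h => hab (congrArg _ h)
  · exact .inl (eps_add_eps_mem_positiveRoots i j)
  · exact .inr (eps_add_eps_mem_positiveRoots j i)
  · exact eps_sub_eps_mem_positiveRoots fun h => hab (congrArg _ h.symm)

/-- `μ` is strictly below `lam` in the dominance order. -/
def IsBelow (lam μ : Weight n) : Prop :=
  (∀ s, IsDominant s → μ ⬝ᵥ s ≤ lam ⬝ᵥ s) ∧ μ ⬝ᵥ rho n < lam ⬝ᵥ rho n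

lemma isBelow_sub {lam μ α : Weight n} (h : μ = lam ∨ IsBelow lam μ) (hα : α ∈ positiveRoots n) :
    IsBelow lam (μ - α) := by
  have h' : (∀ s, IsDominant s → μ ⬝ᵥ s ≤ lam ⬝ᵥ s) ∧ μ ⬝ᵥ rho n ≤ lam ⬝ᵥ rho n := by
    rcases h with rfl | h
    · exact ⟨fun _ _ => le_rfl, le_rfl⟩
    · exact ⟨h.1, h.2.le⟩
  refine ⟨fun s hs => ?_, ?_⟩ <;> rw [sub_dotProduct]
  · linarith [h'.1 s hs, dotProduct_nonneg_of_mem_positiveRoots hα hs]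
  · linarith [h'.2, dotProduct_rho_pos hα]

/-! ### Weights of a simple highest weight module -/

lemma lie_mem_of_rootVec {S T : Submodule ℂ V}
    (h : ∀ a b : Fin n ⊕ Fin n, ∀ w ∈ S, ⁅rootVec a b, w⁆ ∈ T) (y : Sp n) {w : V} (hw : w ∈ S) :
    ⁅y, w⁆ ∈ T := by
  rw [eq_sum_rootVec y, smul_lie, sum_lie]
  refine T.smul_mem _ (T.sum_mem fun a _ => ?_)
  rw [sum_lie]
  refine T.sum_mem fun b _ => ?_
  rw [smul_lie]
  exact T.smul_mem _ (h a b w hw)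

variable (n) in
/-- The subspace `S` is stable under the root vectors of the negative roots. -/
def IsLoweringStable (S : Submodule ℂ V) : Prop :=
  ∀ a b : Fin n ⊕ Fin n, wt b - wt a ∈ positiveRoots n → ∀ w ∈ S, ⁅rootVec a b, w⁆ ∈ S

variable (n) in
/-- The smallest subspace that contains `v` and is stable under the root vectors of the negative
roots. -/
def loweringSpan (v : V) : Submodule ℂ V := sInf {S | v ∈ S ∧ IsLoweringStable n S}

omit [LieModule ℂ (Sp n) V] in
lemma loweringSpan_le {v : V} {S : Submodule ℂ V} (hv : v ∈ S) (hS : IsLoweringStable n S) :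
    loweringSpan n v ≤ S :=
  sInf_le ⟨hv, hS⟩

omit [LieModule ℂ (Sp n) V] in
lemma mem_loweringSpan_self (v : V) : v ∈ loweringSpan n v :=
  Submodule.mem_sInf.2 fun _ hS => hS.1

omit [LieModule ℂ (Sp n) V] in
lemma isLoweringStable_loweringSpan (v : V) : IsLoweringStable n (loweringSpan n v) :=
  fun a b hab w hw => Submodule.mem_sInf.2 fun S hS =>
    hS.2 a b hab w (Submodule.mem_sInf.1 hw S hS)

lemma lie_highestWeightVector_mem_loweringSpan {lam : Weight n} {v : V}
    (hv : IsHighestWeightVector V lam v) (y : Sp n) : ⁅y, v⁆ ∈ loweringSpan n v := by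
  refine lie_mem_of_rootVec (S := Submodule.span ℂ {v}) (fun a b w hw => ?_) y
    (Submodule.mem_span_singleton_self v)
  obtain ⟨c, rfl⟩ := Submodule.mem_span_singleton.1 hw
  rw [lie_smul]
  refine Submodule.smul_mem _ _ ?_
  rcases eq_or_ne a b with rfl | hab
  · rw [rootVec_self_lie a hv.2.1]
    exact Submodule.smul_mem _ _ (mem_loweringSpan_self v)
  rcases wt_sub_wt_mem_positiveRoots hab with hpos | hneg
  · rw [hv.2.2 _ hpos (rootVec a b) fun h => lie_cartan_rootVec h a b]
    exact zero_mem _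
  · exact isLoweringStable_loweringSpan v a b hneg v (mem_loweringSpan_self v)

/-- The submodule generated by a highest weight vector. -/
def highestWeightSubmodule {lam : Weight n} {v : V} (hv : IsHighestWeightVector V lam v) :
    LieSubmodule ℂ (Sp n) V where
  __ := loweringSpan n v
  lie_mem {y w} hw := by
    -- By `y f w = [y, f] w + f y w`, the `w` with this property form a lowering stable subspace.
    let T : Submodule ℂ V := ⨅ y : Sp n, (loweringSpan n v).comap (LieModule.toEnd ℂ (Sp n) V y)
    have mem_T {w : V} : w ∈ T ↔ ∀ y : Sp n, ⁅y, w⁆ ∈ loweringSpan n v := by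
      simp [T, Submodule.mem_iInf]
    have hT : IsLoweringStable n T := by
      intro a b hab w hw
      refine mem_T.2 fun y => ?_
      rw [leibniz_lie]
      exact add_mem (mem_T.1 hw _) (isLoweringStable_loweringSpan v a b hab _ (mem_T.1 hw y))
    exact mem_T.1 (loweringSpan_le (mem_T.2 (lie_highestWeightVector_mem_loweringSpan hv)) hT hw) y

variable (V) in
/-- The sum of the weight spaces of the weights strictly below `lam`. -/
def weightsBelow (lam : Weight n) : Submodule ℂ V := ⨆ μ ∈ {μ | IsBelow lam μ}, weightSpace V μ

lemma rootVec_lie_mem_weightsBelow {lam μ : Weight n} (hμ : μ = lam ∨ IsBelow lam μ)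
    {a b : Fin n ⊕ Fin n} (hab : wt b - wt a ∈ positiveRoots n) {u : V}
    (hu : u ∈ weightSpace V μ) : ⁅rootVec a b, u⁆ ∈ weightsBelow V lam := by
  have hlow := rootVec_lie_mem a b hu
  rw [← neg_sub, ← sub_eq_add_neg] at hlow
  exact le_biSup (weightSpace V) (isBelow_sub hμ hab) hlow

lemma isLoweringStable_span_sup_weightsBelow {lam : Weight n} {v : V} (hv : v ∈ weightSpace V lam) :
    IsLoweringStable n (Submodule.span ℂ {v} ⊔ weightsBelow V lam) := by
  intro a b hab w hw
  suffices h : Submodule.span ℂ {v} ⊔ weightsBelow V lam ≤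
      (weightsBelow V lam).comap (LieModule.toEnd ℂ (Sp n) V (rootVec a b)) from
    Submodule.mem_sup_right (h hw)
  refine sup_le ?_ (iSup₂_le fun μ hμ u hu => rootVec_lie_mem_weightsBelow (.inr hμ) hab hu)
  exact (Submodule.span_singleton_le_iff_mem _ _).2 (rootVec_lie_mem_weightsBelow (.inl rfl) hab hv)

lemma span_sup_weightsBelow_eq_top [LieModule.IsIrreducible ℂ (Sp n) V] {lam : Weight n} {v : V}
    (hv : IsHighestWeightVector V lam v) : Submodule.span ℂ {v} ⊔ weightsBelow V lam = ⊤ := by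
  have hmem : v ∈ highestWeightSubmodule hv := mem_loweringSpan_self v
  have htop : highestWeightSubmodule hv = ⊤ := by
    refine (eq_bot_or_eq_top _).resolve_left fun h => hv.1 ?_
    simpa [h] using hmem
  refine top_le_iff.1 fun w _ => ?_
  have hw : w ∈ highestWeightSubmodule hv := htop ▸ LieSubmodule.mem_top w
  exact loweringSpan_le (Submodule.mem_sup_left (Submodule.mem_span_singleton_self v))
    (isLoweringStable_span_sup_weightsBelow hv.2.1) hw

lemma isBelow_of_mult_ne_zero [LieModule.IsIrreducible ℂ (Sp n) V] {lam : Weight n} {v : V}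
    (hv : IsHighestWeightVector V lam v) {μ : Weight n} (hμ : mult V μ ≠ 0) (hne : μ ≠ lam) :
    IsBelow lam μ := by
  by_contra hb
  have hdisj := (iSupIndep_weightSpace V).disjoint_biSup (x := μ)
    (y := {μ | μ = lam ∨ IsBelow lam μ}) (by simp [hne, hb])
  have htop : (⊤ : Submodule ℂ V) ≤ ⨆ μ ∈ {μ | μ = lam ∨ IsBelow lam μ}, weightSpace V μ := by
    rw [← span_sup_weightsBelow_eq_top hv]
    refine sup_le ((Submodule.span_singleton_le_iff_mem _ _).2 ?_) (biSup_mono fun ν => .inr)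
    exact le_biSup (weightSpace V) (Set.mem_ofPred.2 (.inl rfl)) hv.2.1
  exact hμ (by rw [mult, hdisj.eq_bot_of_le (le_top.trans htop), finrank_bot])

lemma weightSpace_highestWeight [LieModule.IsIrreducible ℂ (Sp n) V] {lam : Weight n} {v : V}
    (hv : IsHighestWeightVector V lam v) : weightSpace V lam = Submodule.span ℂ {v} := by
  have hle : Submodule.span ℂ {v} ≤ weightSpace V lam :=
    (Submodule.span_singleton_le_iff_mem _ _).2 hv.2.1
  have hdisj : Disjoint (weightSpace V lam) (weightsBelow V lam) :=
    (iSupIndep_weightSpace V).disjoint_biSup fun h : IsBelow lam lam => h.2.false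
  calc weightSpace V lam
      = weightSpace V lam ⊓ (Submodule.span ℂ {v} ⊔ weightsBelow V lam) := by
        rw [span_sup_weightsBelow_eq_top hv, inf_top_eq]
    _ = Submodule.span ℂ {v} := by
        rw [inf_comm, sup_inf_assoc_of_le _ hle, hdisj.symm.eq_bot, sup_bot_eq]

lemma mult_highestWeight [LieModule.IsIrreducible ℂ (Sp n) V] {lam : Weight n} {v : V}
    (hv : IsHighestWeightVector V lam v) : mult V lam = 1 := by
  rw [mult, weightSpace_highestWeight hv, finrank_span_singleton hv.1]

end WeightSpaces

/-! ### Invariance of multiplicities under the Weyl group -/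

section Sl2

variable {K V : Type*} [Field K] [CharZero K] [AddCommGroup V] [Module K V]
  {E F H : Module.End K V}

omit [CharZero K] in
lemma apply_pow_of_lie_eq_smul {c : K} (hHE : ⁅H, E⁆ = c • E) {m : K} {u : V} (hu : H u = m • u)
    (i : ℕ) : H ((E ^ i) u) = (m + c * i) • (E ^ i) u := by
  induction i with
  | zero => simpa using hu
  | succ i ih =>
    have h := LinearMap.congr_fun hHE ((E ^ i) u)
    simp only [Ring.lie_def, LinearMap.sub_apply, Module.End.mul_apply, LinearMap.smul_apply] at h
    rw [pow_succ', Module.End.mul_apply, sub_eq_iff_eq_add.1 h, ih, map_smul, ← add_smul]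
    congr 1
    push_cast
    ring

lemma exists_pow_apply_eq_zero [FiniteDimensional K V] {c : K} (hc : c ≠ 0) (hHE : ⁅H, E⁆ = c • E)
    {m : K} {u : V} (hu : H u = m • u) : ∃ i, (E ^ i) u = 0 := by
  by_contra! hne
  have hinj : Function.Injective fun i : ℕ => m + c * i := fun i j hij => by simpa [hc] using hij
  refine Set.infinite_range_of_injective hinj ((Module.End.finite_hasEigenvalue H).subset ?_)
  rintro _ ⟨i, rfl⟩
  exact Module.End.hasEigenvalue_of_hasEigenvector
    ⟨Module.End.mem_eigenspace_iff.2 (apply_pow_of_lie_eq_smul hHE hu i), hne i⟩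

omit [CharZero K] in
lemma apply_pow_succ_lower (hEF : ⁅E, F⁆ = H) (hHF : ⁅H, F⁆ = (-2 : K) • F) {m : K} {u : V}
    (hu : H u = m • u) (i : ℕ) :
    E ((F ^ (i + 1)) u) = (F ^ (i + 1)) (E u) + ((i + 1) * (m - i)) • (F ^ i) u := by
  have hlie (w : V) : E (F w) = F (E w) + H w := by
    rw [← hEF, Ring.lie_def]
    simp
  induction i with
  | zero => simp [hlie, hu]
  | succ i ih =>
    rw [pow_succ', Module.End.mul_apply, hlie, ih, apply_pow_of_lie_eq_smul hHF hu, map_add,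
      map_smul, ← Module.End.mul_apply, ← pow_succ', ← Module.End.mul_apply F, ← pow_succ',
      add_assoc, ← add_smul]
    congr 2
    push_cast
    ring

lemma eq_zero_of_pow_lower_eq_zero_of_primitive (hEF : ⁅E, F⁆ = H) (hHF : ⁅H, F⁆ = (-2 : K) • F)
    {k : ℕ} {v : V} (hv : H v = (k : K) • v) (hE : E v = 0) (hF : (F ^ k) v = 0) : v = 0 := by
  suffices h : ∀ i ≤ k, (F ^ i) v = 0 → v = 0 from h k le_rfl hF
  intro i hi hFi
  induction i with
  | zero => simpa using hFi
  | succ i ih =>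
    have h := apply_pow_succ_lower hEF hHF hv i
    have hcoeff : ((i : K) + 1) * (k - i) ≠ 0 :=
      mul_ne_zero (by exact_mod_cast i.succ_ne_zero)
        (sub_ne_zero.2 (by exact_mod_cast (show k ≠ i by lia)))
    rw [hFi, hE, map_zero, map_zero, zero_add] at h
    exact ih (by lia) ((smul_eq_zero.1 h.symm).resolve_left hcoeff)

-- `E v` satisfies the hypotheses with `k + 2` for `k`, so descending along the powers of `E` leads
-- to the primitive case.
lemma eq_zero_of_pow_lower_eq_zero [FiniteDimensional K V] (hEF : ⁅E, F⁆ = H)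
    (hHE : ⁅H, E⁆ = (2 : K) • E) (hHF : ⁅H, F⁆ = (-2 : K) • F) {k : ℕ} {v : V}
    (hv : H v = (k : K) • v) (hF : (F ^ k) v = 0) : v = 0 := by
  obtain ⟨N, hN⟩ := exists_pow_apply_eq_zero two_ne_zero hHE hv
  induction N generalizing k v with
  | zero => simpa using hN
  | succ N ih =>
    have hF' : (F ^ (k + 1)) v = 0 := by rw [pow_succ', Module.End.mul_apply, hF, map_zero]
    have hE : E v = 0 := by
      refine ih (k := k + 2) ?_ ?_ hN
      · simpa using apply_pow_of_lie_eq_smul hHE hv 1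
      · have h := apply_pow_succ_lower hEF hHF hv (k + 1)
        have hF'' : (F ^ (k + 1 + 1)) v = 0 := by
          rw [pow_succ', Module.End.mul_apply, hF', map_zero]
        rwa [hF'', hF', map_zero, smul_zero, add_zero, eq_comm] at h
    exact eq_zero_of_pow_lower_eq_zero_of_primitive hEF hHF hv hE hF

end Sl2

section WeylInvariance

open Matrix

variable {n : ℕ} {V : Type} [AddCommGroup V] [Module ℂ V] [LieRingModule (Sp n) V]
  [LieModule ℂ (Sp n) V]

-- Here `t` is the coroot of `α`, and `k = ⟨μ, α^∨⟩`.
lemma mult_le_mult_sub [FiniteDimensional ℂ V] {α : Weight n} {x y : Sp n} {t : Fin n → ℂ}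
    (hx : ∀ h, ⁅cartan h, x⁆ = evalWeight α h • x) (hy : ∀ h, ⁅cartan h, y⁆ = evalWeight (-α) h • y)
    (hxy : ⁅x, y⁆ = cartan t) (hα : evalWeight α t = 2) {μ : Weight n} {k : ℕ}
    (hk : evalWeight μ t = k) : mult V μ ≤ mult V (μ - k • α) := by
  let φ := LieModule.toEnd ℂ (Sp n) V
  have hEF : ⁅φ x, φ y⁆ = φ (cartan t) := by rw [← LieHom.map_lie, hxy]
  have hHE : ⁅φ (cartan t), φ x⁆ = (2 : ℂ) • φ x := by rw [← LieHom.map_lie, hx, hα, map_smul]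
  have hHF : ⁅φ (cartan t), φ y⁆ = (-2 : ℂ) • φ y := by
    rw [← LieHom.map_lie, hy, evalWeight_neg, hα, map_smul]
  have hmem (i : ℕ) (v : V) (hv : v ∈ weightSpace V μ) :
      (φ y ^ i) v ∈ weightSpace V (μ - i • α) := by
    induction i with
    | zero => simpa using hv
    | succ i ih =>
      rw [pow_succ', Module.End.mul_apply, succ_nsmul, ← sub_sub, sub_eq_add_neg _ α]
      exact lie_mem_weightSpace hy ih
  refine LinearMap.finrank_le_finrank_of_injective (f := (φ y ^ k).restrict (hmem k)) ?_
  rw [← LinearMap.ker_eq_bot, LinearMap.ker_eq_bot']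
  rintro ⟨v, hv⟩ h
  refine Subtype.ext (eq_zero_of_pow_lower_eq_zero hEF hHE hHF (k := k) ?_ (congrArg Subtype.val h))
  rw [← hk]
  exact mem_weightSpace.1 hv t

lemma lie_rootVec_smul_rootVec {a b : Fin n ⊕ Fin n} (hab : a ≠ b) (c : ℂ) :
    ⁅rootVec a b, c • rootVec b a⁆ =
      cartan ((c * longFactor a b) • fun i => ((wt a - wt b) i : ℂ)) := by
  rw [lie_smul, lie_rootVec_rootVec hab, rootVec_self, rootVec_self, smul_smul]
  apply Subtype.ext
  rw [SetLike.val_smul, AddSubgroupClass.coe_sub, cartan_val, cartan_val, cartan_val, diagonal_sub,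
    ← diagonal_smul]
  congr 1
  ext (i | i)
  · simp
  · simp only [Sum.elim_inr, Pi.sub_apply, Pi.smul_apply, smul_eq_mul, Int.cast_sub]
    ring

lemma evalWeight_smul_wt_sub_wt (μ : Weight n) (a b : Fin n ⊕ Fin n) (c : ℂ) :
    evalWeight μ (c • fun i => ((wt a - wt b) i : ℂ)) = c * (coord μ a - coord μ b) := by
  simp only [evalWeight, Pi.smul_apply, smul_eq_mul, mul_left_comm _ c, ← Finset.mul_sum,
    ← sum_mul_wt]
  push_cast
  simp only [Pi.sub_apply, Int.cast_sub, mul_sub, Finset.sum_sub_distrib]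

lemma mult_le_mult_sub_wt [FiniteDimensional ℂ V] {a b : Fin n ⊕ Fin n} (hab : a ≠ b) {c : ℂ}
    (hc : c * longFactor a b * (coord (wt a - wt b) a - coord (wt a - wt b) b) = 2)
    {μ : Weight n} {k : ℕ} (hk : c * longFactor a b * (coord μ a - coord μ b) = k) :
    mult V μ ≤ mult V (μ - k • (wt a - wt b)) := by
  refine mult_le_mult_sub (fun h => lie_cartan_rootVec h a b) (fun h => ?_)
    (lie_rootVec_smul_rootVec hab c) ?_ ?_
  · rw [lie_smul, lie_cartan_rootVec, smul_comm, neg_sub]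
  · rw [evalWeight_smul_wt_sub_wt, hc]
  · rw [evalWeight_smul_wt_sub_wt, hk]

lemma mult_le_mult_comp_swap [FiniteDimensional ℂ V] {μ : Weight n} {i j : Fin n} (hij : i ≠ j)
    (h : μ j ≤ μ i) : mult V μ ≤ mult V (μ ∘ Equiv.swap i j) := by
  obtain ⟨k, hk⟩ := Int.eq_ofNat_of_zero_le (sub_nonneg.2 h)
  have hle := mult_le_mult_sub_wt (V := V) (a := .inl i) (b := .inl j) (by simpa using hij) (c := 1)
    (μ := μ) (k := k) (by simp [longFactor, coord, wt, eps, hij, hij.symm, one_add_one_eq_two])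
    (by simpa [longFactor, coord] using congrArg (Int.cast : ℤ → ℂ) hk)
  refine hle.trans_eq (congrArg _ (funext fun l => ?_))
  simp only [Pi.sub_apply, nsmul_eq_mul, wt, Sum.elim_inl, eps, Function.comp,
    Equiv.swap_apply_def]
  split_ifs <;> simp_all [← hk]

lemma mult_comp_swap [FiniteDimensional ℂ V] (μ : Weight n) (i j : Fin n) :
    mult V (μ ∘ Equiv.swap i j) = mult V μ := by
  rcases eq_or_ne i j with rfl | hij
  · simp
  have hle (μ : Weight n) : mult V μ ≤ mult V (μ ∘ Equiv.swap i j) := by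
    rcases le_total (μ j) (μ i) with h | h
    · exact mult_le_mult_comp_swap hij h
    · rw [Equiv.swap_comm]
      exact mult_le_mult_comp_swap hij.symm h
  refine le_antisymm ((hle _).trans_eq ?_) (hle μ)
  rw [Function.comp_assoc, ← Equiv.coe_trans, Equiv.swap_swap, Equiv.coe_refl, Function.comp_id]

lemma mult_comp_perm [FiniteDimensional ℂ V] (σ : Equiv.Perm (Fin n)) (μ : Weight n) :
    mult V (μ ∘ σ) = mult V μ := by
  induction σ using Equiv.Perm.swap_induction_on generalizing μ with
  | one => rfl
  | swap_mul σ i j _ ih =>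
    rw [Equiv.Perm.coe_mul, ← Function.comp_assoc, ih, mult_comp_swap]

lemma mult_le_mult_sub_two_mul_coord [FiniteDimensional ℂ V] {μ : Weight n} (a : Fin n ⊕ Fin n)
    {k : ℕ} (hk : coord μ a = k) : mult V μ ≤ mult V (μ - k • (wt a - wt a.swap)) := by
  refine mult_le_mult_sub_wt (c := 1 / 4) ?_ ?_ ?_
  · rcases a with i | i <;> simp
  · rcases a with i | i <;> simp [longFactor, coord, wt, eps] <;> norm_num
  · rcases a with i | i <;> simp [longFactor, ← Int.cast_natCast (R := ℂ), ← hk, coord] <;> ring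

lemma mult_update_neg [FiniteDimensional ℂ V] (μ : Weight n) (i : Fin n) :
    mult V (Function.update μ i (-μ i)) = mult V μ := by
  have hle (μ : Weight n) : mult V μ ≤ mult V (Function.update μ i (-μ i)) := by
    rcases le_total 0 (μ i) with h | h
    · obtain ⟨k, hk⟩ := Int.eq_ofNat_of_zero_le h
      refine (mult_le_mult_sub_two_mul_coord (.inl i) hk).trans_eq (congrArg _ (funext fun l => ?_))
      rcases eq_or_ne l i with rfl | hl
      · simp [wt, eps, hk]
      · simp [wt, eps, hl]
    · obtain ⟨k, hk⟩ := Int.eq_ofNat_of_zero_le (neg_nonneg.2 h)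
      refine (mult_le_mult_sub_two_mul_coord (.inr i) hk).trans_eq (congrArg _ (funext fun l => ?_))
      rcases eq_or_ne l i with rfl | hl
      · simp only [wt, eps, Sum.elim_inr, Sum.swap_inr, Sum.elim_inl, nsmul_eq_mul, Pi.sub_apply,
          Pi.mul_apply, Pi.natCast_apply, ← hk, Pi.neg_apply, Pi.single_eq_same,
          Function.update_self]
        ring
      · simp [wt, eps, hl]
  exact le_antisymm ((hle _).trans_eq (by simp)) (hle μ)

lemma mult_units_mul [FiniteDimensional ℂ V] (s : Fin n → ℤˣ) (μ : Weight n) :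
    mult V (fun i => (s i : ℤ) * μ i) = mult V μ := by
  induction s using Pi.mulSingle_induction generalizing μ with
  | one => simp
  | mul s t hs ht => simpa [mul_assoc] using (hs fun i => (t i : ℤ) * μ i).trans (ht μ)
  | mulSingle i u =>
    rcases Int.units_eq_one_or u with rfl | rfl
    · simp
    · rw [← mult_update_neg μ i]
      congr 1
      ext l
      rcases eq_or_ne l i with rfl | hl
      · simp
      · simp [hl]

end WeylInvariance

/-! ### The Casimir operator and traces on weight spaces -/

-- Schur's lemma.
lemma exists_lieModuleHom_eq_smul {𝕜 L V : Type*} [Field 𝕜] [IsAlgClosed 𝕜] [LieRing L]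
    [LieAlgebra 𝕜 L] [AddCommGroup V] [Module 𝕜 V] [LieRingModule L V] [LieModule 𝕜 L V]
    [FiniteDimensional 𝕜 V] [LieModule.IsIrreducible 𝕜 L V] (f : V →ₗ⁅𝕜,L⁆ V) :
    ∃ c : 𝕜, ∀ v, f v = c • v := by
  have := LieModule.nontrivial_of_isIrreducible 𝕜 L V
  obtain ⟨c, hc⟩ := Module.End.exists_eigenvalue (f : V →ₗ[𝕜] V)
  obtain ⟨u, hu, hu0⟩ := hc.exists_hasEigenvector
  refine ⟨c, fun v => ?_⟩
  have hmem (w : V) : w ∈ (f - c • LieModuleHom.id).ker ↔ f w = c • w := by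
    simp [sub_eq_zero]
  have hker : (f - c • LieModuleHom.id).ker = ⊤ := by
    refine (eq_bot_or_eq_top _).resolve_left fun hbot => hu0 ?_
    rw [← LieSubmodule.mem_bot (R := 𝕜) (L := L), ← hbot, hmem]
    exact Module.End.mem_eigenspace_iff.1 hu
  rw [← hmem, hker]
  exact LieSubmodule.mem_top v

section Casimir

open Matrix

variable (n : ℕ) (V : Type) [AddCommGroup V] [Module ℂ V] [LieRingModule (Sp n) V]
  [LieModule ℂ (Sp n) V]

/-- The Casimir operator, normalized as a sum over pairs of signed indices. -/
def casimir : Module.End ℂ V :=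
  ∑ a, ∑ b, LieModule.toEnd ℂ (Sp n) V (rootVec a b) * LieModule.toEnd ℂ (Sp n) V (rootVec b a)

lemma commute_toEnd_casimir (y : Sp n) : Commute (LieModule.toEnd ℂ (Sp n) V y) (casimir n V) := by
  let φ := LieModule.toEnd ℂ (Sp n) V
  let f : Matrix (Fin n ⊕ Fin n) (Fin n ⊕ Fin n) ℂ →ₗ[ℂ] Module.End ℂ V :=
    (φ : Sp n →ₗ[ℂ] Module.End ℂ V) ∘ₗ spProj
  have hf (X) : f ⁅y.1, X⁆ = φ y * f X - f X * φ y := by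
    change φ (spProj _) = φ y * φ (spProj X) - φ (spProj X) * φ y
    rw [← lie_spProj, LieHom.map_lie, Ring.lie_def]
  have hinv := sum_bilin_lie_single ((LinearMap.mul ℂ (Module.End ℂ V)).compl₁₂ f f) y.1
  rw [commute_iff_eq, ← sub_eq_zero, ← hinv, casimir]
  simp only [Finset.mul_sum, Finset.sum_mul, ← Finset.sum_sub_distrib]
  refine Finset.sum_congr rfl fun a _ => Finset.sum_congr rfl fun b _ => ?_
  rw [LinearMap.compl₁₂_apply, LinearMap.compl₁₂_apply, hf, hf, LinearMap.mul_apply',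
    LinearMap.mul_apply']
  change φ y * (f _ * f _) - f _ * f _ * φ y = _
  noncomm_ring

/-- The Casimir operator as a homomorphism of modules, which is what Schur's lemma asks for. -/
def casimirHom : V →ₗ⁅ℂ, Sp n⁆ V :=
  { casimir n V with
    map_lie' := fun {y v} => (LinearMap.congr_fun (commute_toEnd_casimir n V y).eq v).symm }

lemma exists_casimir_eq_smul [FiniteDimensional ℂ V] [LieModule.IsIrreducible ℂ (Sp n) V] :
    ∃ c : ℂ, ∀ v : V, casimir n V v = c • v :=
  exists_lieModuleHom_eq_smul (casimirHom n V)

variable {n}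

lemma rootVec_mul_rootVec_mem (a b : Fin n ⊕ Fin n) (μ : Weight n) :
    ∀ v ∈ weightSpace V μ,
      (LieModule.toEnd ℂ (Sp n) V (rootVec a b) * LieModule.toEnd ℂ (Sp n) V (rootVec b a)) v ∈
        weightSpace V μ := by
  intro v hv
  have h := rootVec_lie_mem a b (rootVec_lie_mem b a hv)
  rwa [show μ + (wt b - wt a) + (wt a - wt b) = μ by abel] at h

/-- The trace of the summand `X_{ab} X_{ba}` of the Casimir operator on a weight space. -/
def loopTrace (a b : Fin n ⊕ Fin n) (μ : Weight n) : ℂ :=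
  LinearMap.trace ℂ (weightSpace V μ) (LinearMap.restrict _ (rootVec_mul_rootVec_mem V a b μ))

variable [FiniteDimensional ℂ V]

lemma loopTrace_comm (a b : Fin n ⊕ Fin n) (μ : Weight n) :
    loopTrace V a b μ = loopTrace V b a (μ - (wt a - wt b)) := by
  let f : weightSpace V μ →ₗ[ℂ] weightSpace V (μ - (wt a - wt b)) :=
    (LieModule.toEnd ℂ (Sp n) V (rootVec b a)).restrict fun v hv => by
      have h := rootVec_lie_mem b a hv
      rwa [show μ + (wt b - wt a) = μ - (wt a - wt b) by abel] at h
  let g : weightSpace V (μ - (wt a - wt b)) →ₗ[ℂ] weightSpace V μ :=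
    (LieModule.toEnd ℂ (Sp n) V (rootVec a b)).restrict fun v hv => by
      have h := rootVec_lie_mem a b hv
      rwa [show μ - (wt a - wt b) + (wt a - wt b) = μ by abel] at h
  exact LinearMap.trace_comp_comm' f g

lemma trace_weightSpace_smul_id (c : ℂ) (μ : Weight n) :
    LinearMap.trace ℂ (weightSpace V μ) (c • LinearMap.id) = c * mult V μ := by
  rw [map_smul, LinearMap.trace_id, smul_eq_mul, mult]

lemma loopTrace_sub {a b : Fin n ⊕ Fin n} (hab : a ≠ b) (μ : Weight n) :
    loopTrace V a b μ - loopTrace V b a μ =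
      ((longFactor a b * (coord μ a - coord μ b) : ℤ) : ℂ) * mult V μ := by
  rw [loopTrace, loopTrace, ← map_sub, ← trace_weightSpace_smul_id]
  congr 1
  ext ⟨v, hv⟩
  have h := congrArg (fun x : Sp n => ⁅x, v⁆) (lie_rootVec_rootVec hab)
  simp only [lie_lie, smul_lie, sub_lie, rootVec_self_lie _ hv, ← sub_smul, smul_smul] at h
  simp only [LinearMap.sub_apply, AddSubgroupClass.coe_sub, LinearMap.coe_restrict_apply,
    Module.End.mul_apply, LieModule.toEnd_apply_apply, LinearMap.smul_apply, LinearMap.id_apply,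
    SetLike.val_smul]
  rw [h]
  push_cast
  rfl

lemma loopTrace_self (a : Fin n ⊕ Fin n) (μ : Weight n) :
    loopTrace V a a μ = ((coord μ a ^ 2 : ℤ) : ℂ) * mult V μ := by
  rw [loopTrace, ← trace_weightSpace_smul_id]
  congr 1
  ext ⟨v, hv⟩
  simp only [LinearMap.coe_restrict_apply, Module.End.mul_apply, LieModule.toEnd_apply_apply,
    LinearMap.smul_apply, LinearMap.id_apply, SetLike.val_smul, rootVec_self_lie _ hv, lie_smul,
    smul_smul]
  push_cast
  rw [sq]

lemma sum_loopTrace {c : ℂ} (hc : ∀ v : V, casimir n V v = c • v) (μ : Weight n) :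
    ∑ a, ∑ b, loopTrace V a b μ = c * mult V μ := by
  simp only [loopTrace, ← map_sum]
  rw [← trace_weightSpace_smul_id]
  congr 1
  ext ⟨v, hv⟩
  have h := hc v
  simp only [casimir, LinearMap.sum_apply] at h
  simp only [LinearMap.sum_apply, AddSubmonoidClass.coe_finsetSum, LinearMap.coe_restrict_apply,
    LinearMap.smul_apply, LinearMap.id_apply, SetLike.val_smul]
  exact h

lemma loopTrace_eq_zero {a b : Fin n ⊕ Fin n} {μ : Weight n} (h : mult V μ = 0) :
    loopTrace V a b μ = 0 := by
  have : Subsingleton (weightSpace V μ) := Module.finrank_zero_iff.1 h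
  rw [loopTrace, Subsingleton.elim (LinearMap.restrict _ (rootVec_mul_rootVec_mem V a b μ)) 0,
    map_zero]

end Casimir

/-! ### Differential operators on the group algebra -/

section GroupAlgebra

open AddMonoidAlgebra
open scoped Matrix

variable {n : ℕ}

/-- The diagonal operator that multiplies the basis element at `m` by `g m`. -/
def scale {R M : Type*} [Semiring R] (g : M → R) : R[M] →+ R[M] where
  toFun f := ofCoeff (Finsupp.onFinset f.coeff.support (fun m => g m * f.coeff m) fun m hm =>
    Finsupp.mem_support_iff.2 (right_ne_zero_of_mul hm))
  map_zero' := by ext; simp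
  map_add' f f' := by ext; simp [mul_add]

lemma coeff_scale {R M : Type*} [Semiring R] (g : M → R) (f : R[M]) (m : M) :
    (scale g f).coeff m = g m * f.coeff m := by
  simp [scale]

lemma scale_single {R M : Type*} [Semiring R] (g : M → R) (m : M) (c : R) :
    scale g (single m c) = single m (g m * c) := by
  ext m'
  rw [coeff_scale]
  rcases eq_or_ne m m' with rfl | hm
  · simp
  · simp [coeff_single, hm]

/-- The partial derivative `e^μ ↦ μ_i e^μ`. -/
def pderiv (i : Fin n) : GroupAlg n →+ GroupAlg n := scale fun μ => (μ i : K)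

/-- The Laplacian `e^μ ↦ (μ, μ) e^μ`. -/
def laplacian : GroupAlg n →+ GroupAlg n := scale fun μ => ((μ ⬝ᵥ μ : ℤ) : K)

lemma pderiv_mul (i : Fin n) (f g : GroupAlg n) :
    pderiv i (f * g) = pderiv i f * g + f * pderiv i g := by
  induction f using AddMonoidAlgebra.induction_linear with
  | zero => simp
  | add f₁ f₂ h₁ h₂ =>
    rw [add_mul, map_add, h₁, h₂, map_add]
    ring
  | single μ a =>
    induction g using AddMonoidAlgebra.induction_linear with
    | zero => simp
    | add f₁ f₂ h₁ h₂ =>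
      rw [mul_add, map_add, h₁, h₂, map_add]
      ring
    | single ν b =>
      simp only [pderiv, single_mul_single, scale_single, ← single_add]
      congr 1
      simp only [Pi.add_apply]
      push_cast
      ring

lemma laplacian_mul (f g : GroupAlg n) :
    laplacian (f * g) = laplacian f * g + 2 * ∑ i, pderiv i f * pderiv i g + f * laplacian g := by
  induction f using AddMonoidAlgebra.induction_linear with
  | zero => simp
  | add f₁ f₂ h₁ h₂ =>
    simp only [add_mul, map_add, h₁, h₂, Finset.sum_add_distrib]
    ring
  | single μ a =>
    induction g using AddMonoidAlgebra.induction_linear with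
    | zero => simp
    | add f₁ f₂ h₁ h₂ =>
      simp only [mul_add, map_add, h₁, h₂, Finset.sum_add_distrib]
      ring
    | single ν b =>
      have hcross : ∑ i, (μ i : K) * a * ((ν i : K) * b) = ((μ ⬝ᵥ ν : ℤ) : K) * (a * b) := by
        simp only [dotProduct, Int.cast_sum, Int.cast_mul, Finset.sum_mul]
        exact Finset.sum_congr rfl fun i _ => by ring
      have hsum : ∑ i, single (μ + ν) ((μ i : K) * a * ((ν i : K) * b)) =
          (single (μ + ν) (((μ ⬝ᵥ ν : ℤ) : K) * (a * b)) : GroupAlg n) := by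
        rw [← hcross]
        exact (map_sum (singleAddHom (μ + ν)) _ _).symm
      simp only [laplacian, pderiv, single_mul_single, scale_single, hsum, two_mul, ← single_add]
      congr 1
      simp only [add_dotProduct, dotProduct_add, dotProduct_comm ν μ]
      push_cast
      ring

/-- The logarithmic derivative `∂_i f / f`, which is additive on products. -/
def dlog (i : Fin n) (f : GroupAlg n) : Frac n :=
  algebraMap (GroupAlg n) (Frac n) (pderiv i f) / algebraMap (GroupAlg n) (Frac n) f

lemma algebraMap_ne_zero {f : GroupAlg n} (hf : f ≠ 0) :
    algebraMap (GroupAlg n) (Frac n) f ≠ 0 :=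
  (map_ne_zero_iff _ (IsFractionRing.injective _ _)).2 hf

lemma algebraMap_pderiv {f : GroupAlg n} (hf : f ≠ 0) (i : Fin n) :
    algebraMap (GroupAlg n) (Frac n) (pderiv i f) =
      algebraMap (GroupAlg n) (Frac n) f * dlog i f :=
  (mul_div_cancel₀ _ (algebraMap_ne_zero hf)).symm

lemma dlog_mul {f g : GroupAlg n} (hf : f ≠ 0) (hg : g ≠ 0) (i : Fin n) :
    dlog i (f * g) = dlog i f + dlog i g := by
  have hf' := algebraMap_ne_zero hf
  have hg' := algebraMap_ne_zero hg
  simp only [dlog, pderiv_mul, map_add, map_mul]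
  field_simp

lemma dlog_prod {ι : Type*} (i : Fin n) {S : Finset ι} {f : ι → GroupAlg n}
    (hf : ∀ s ∈ S, f s ≠ 0) : dlog i (∏ s ∈ S, f s) = ∑ s ∈ S, dlog i (f s) := by
  classical
  induction S using Finset.induction_on with
  | empty => simp [dlog, pderiv, one_def, scale_single]
  | insert s S hs ih =>
    rw [Finset.forall_mem_insert] at hf
    rw [Finset.prod_insert hs, Finset.sum_insert hs,
      dlog_mul hf.1 (Finset.prod_ne_zero_iff.2 hf.2), ih hf.2]

lemma expo_add (μ ν : Weight n) : expo (μ + ν) = expo μ * expo ν := by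
  rw [expo, expo, expo, ← map_mul, single_mul_single, one_mul]

lemma expo_zero : expo (0 : Weight n) = 1 := by
  rw [expo, ← one_def, map_one]

lemma expo_ne_zero (μ : Weight n) : expo μ ≠ 0 := by
  have h := expo_add μ (-μ)
  rw [add_neg_cancel, expo_zero] at h
  exact left_ne_zero_of_mul_eq_one h.symm

lemma expo_neg (μ : Weight n) : expo (-μ) = (expo μ)⁻¹ := by
  have h := expo_add μ (-μ)
  rw [add_neg_cancel, expo_zero] at h
  exact (inv_eq_of_mul_eq_one_right h.symm).symm

lemma expo_sub (μ ν : Weight n) : expo (μ - ν) = expo μ / expo ν := by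
  rw [sub_eq_add_neg, expo_add, expo_neg, div_eq_mul_inv]

lemma expo_zsmul (m : ℤ) (μ : Weight n) : expo (m • μ) = expo μ ^ m := by
  let f : Multiplicative (Weight n) →* (Frac n) :=
    { toFun := fun μ => expo μ.toAdd, map_one' := expo_zero, map_mul' := fun _ _ => expo_add _ _ }
  exact map_zpow' f (fun μ => expo_neg μ.toAdd) (Multiplicative.ofAdd μ) m

lemma expo_injective : Function.Injective (expo (n := n)) := by
  intro μ ν h
  exact single_left_injective one_ne_zero (IsFractionRing.injective (GroupAlg n) (Frac n) h)

/-- The variables `x_i = e^{ε_i}`. -/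
def xvar (n : ℕ) (i : Fin n) : Frac n := expo (eps i)

lemma xvar_ne_zero (i : Fin n) : xvar n i ≠ 0 := expo_ne_zero _

lemma xvar_sub_inv_ne_zero (i j : Fin n) : xvar n i - (xvar n j)⁻¹ ≠ 0 := by
  rw [xvar, xvar, ← expo_neg, sub_ne_zero]
  intro h
  have hcoord := congrFun (expo_injective h) i
  rcases eq_or_ne i j with rfl | hij
  · simp [eps] at hcoord
  · simp [eps, hij] at hcoord

lemma xvar_sub_ne_zero {i j : Fin n} (hij : i ≠ j) : xvar n i - xvar n j ≠ 0 := by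
  rw [xvar, xvar, sub_ne_zero]
  intro h
  have hcoord := congrFun (expo_injective h) i
  simp [eps, hij] at hcoord

lemma xvar_add_inv_sub_ne_zero {i j : Fin n} (hij : i ≠ j) :
    xvar n i + (xvar n i)⁻¹ - (xvar n j + (xvar n j)⁻¹) ≠ 0 := by
  have hi := xvar_ne_zero i
  have hj := xvar_ne_zero j
  have hfactor : xvar n i + (xvar n i)⁻¹ - (xvar n j + (xvar n j)⁻¹) =
      (xvar n i - xvar n j) * (xvar n i - (xvar n j)⁻¹) / xvar n i := by
    field_simp
    ring
  rw [hfactor]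
  exact div_ne_zero (mul_ne_zero (xvar_sub_ne_zero hij) (xvar_sub_inv_ne_zero i j)) hi

lemma weylDenom_xvar_ne_zero : weylDenom (xvar n) ≠ 0 :=
  mul_ne_zero (Finset.prod_ne_zero_iff.2 fun i _ => xvar_sub_inv_ne_zero i i)
    (Finset.prod_ne_zero_iff.2 fun _ _ => Finset.prod_ne_zero_iff.2 fun _ hj =>
      xvar_add_inv_sub_ne_zero (Finset.mem_Ioi.1 hj).ne)

/-- The element `e^{ε_i} - e^{-ε_i}`. -/
def oddVar (i : Fin n) : GroupAlg n := single (eps i) 1 - single (-eps i) 1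

/-- The element `e^{ε_i} + e^{-ε_i}`. -/
def evenVar (i : Fin n) : GroupAlg n := single (eps i) 1 + single (-eps i) 1

lemma algebraMap_oddVar (i : Fin n) :
    algebraMap (GroupAlg n) (Frac n) (oddVar i) = xvar n i - (xvar n i)⁻¹ := by
  rw [oddVar, map_sub, xvar, ← expo_neg]
  rfl

lemma algebraMap_evenVar (i : Fin n) :
    algebraMap (GroupAlg n) (Frac n) (evenVar i) = xvar n i + (xvar n i)⁻¹ := by
  rw [evenVar, map_add, xvar, ← expo_neg]
  rfl

lemma pderiv_oddVar (p i : Fin n) : pderiv p (oddVar i) = if i = p then evenVar i else 0 := by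
  rw [oddVar, evenVar, map_sub, pderiv, scale_single, scale_single]
  split_ifs with h
  · simp [eps, h]
  · simp [eps, Ne.symm h]

lemma pderiv_evenVar (p i : Fin n) : pderiv p (evenVar i) = if i = p then oddVar i else 0 := by
  rw [oddVar, evenVar, map_add, pderiv, scale_single, scale_single]
  split_ifs with h
  · simp [eps, h, sub_eq_add_neg]
  · simp [eps, Ne.symm h]

/-- The Weyl denominator in the group algebra. -/
def denomAlg (n : ℕ) : GroupAlg n :=
  (∏ i, oddVar i) * ∏ i, ∏ j ∈ Finset.Ioi i, (evenVar i - evenVar j)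

lemma algebraMap_denomAlg : algebraMap (GroupAlg n) (Frac n) (denomAlg n) = weylDenom (xvar n) := by
  simp only [denomAlg, weylDenom, map_mul, map_prod, map_sub, algebraMap_oddVar,
    algebraMap_evenVar]

lemma denomAlg_ne_zero : denomAlg n ≠ 0 := fun h =>
  weylDenom_xvar_ne_zero (n := n) (by rw [← algebraMap_denomAlg, h, map_zero])

lemma sum_sum_Ioi_eq_sum_erase {ι M : Type*} [LinearOrder ι] [Fintype ι] [LocallyFiniteOrderTop ι]
    [AddCommMonoid M] {g : ι → ι → M} (p : ι) (hsymm : ∀ i j, g i j = g j i)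
    (hg : ∀ i j, i ≠ p → j ≠ p → g i j = 0) :
    ∑ i, ∑ j ∈ Finset.Ioi i, g i j = ∑ j ∈ Finset.univ.erase p, g p j := by
  have hrow (i : ι) (hi : i ≠ p) : ∑ j ∈ Finset.Ioi i, g i j = if i < p then g p i else 0 := by
    split_ifs with hip
    · rw [Finset.sum_eq_single_of_mem p (Finset.mem_Ioi.2 hip) fun j _ hj => hg i j hi hj, hsymm]
    · refine Finset.sum_eq_zero fun j hj => hg i j hi ?_
      rintro rfl
      exact hip (Finset.mem_Ioi.1 hj)
  have hgt : (Finset.univ.erase p).filter (fun j => ¬ j < p) = Finset.Ioi p := by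
    ext j
    simp only [Finset.mem_filter, Finset.mem_erase, Finset.mem_univ, Finset.mem_Ioi, not_lt]
    exact ⟨fun h => h.2.lt_of_ne' h.1.1, fun h => ⟨⟨h.ne', trivial⟩, h.le⟩⟩
  rw [← Finset.sum_filter_add_sum_filter_not (Finset.univ.erase p) (· < p) (g p), hgt,
    ← Finset.sum_erase_add _ _ (Finset.mem_univ p), Finset.sum_filter]
  congr 1
  exact Finset.sum_congr rfl fun i hi => hrow i (Finset.ne_of_mem_erase hi)

lemma dlog_denomAlg (p : Fin n) :
    dlog p (denomAlg n) =
      (xvar n p + (xvar n p)⁻¹) / (xvar n p - (xvar n p)⁻¹) +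
        ∑ j ∈ Finset.univ.erase p, (xvar n p - (xvar n p)⁻¹) /
          (xvar n p + (xvar n p)⁻¹ - (xvar n j + (xvar n j)⁻¹)) := by
  have hne := denomAlg_ne_zero (n := n)
  have hodd := left_ne_zero_of_mul hne
  have heven := right_ne_zero_of_mul hne
  rw [denomAlg, dlog_mul hodd heven, dlog_prod p (Finset.prod_ne_zero_iff.1 hodd),
    dlog_prod p (Finset.prod_ne_zero_iff.1 heven), Finset.sum_congr rfl fun i hi =>
      dlog_prod p (Finset.prod_ne_zero_iff.1 (Finset.prod_ne_zero_iff.1 heven i hi))]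
  congr 1
  · rw [Finset.sum_eq_single p (fun i _ hi => by simp [dlog, pderiv_oddVar, hi]) (by simp), dlog,
      pderiv_oddVar, if_pos rfl, algebraMap_oddVar, algebraMap_evenVar]
  · rw [sum_sum_Ioi_eq_sum_erase p]
    · refine Finset.sum_congr rfl fun j hj => ?_
      simp only [dlog, map_sub, pderiv_evenVar, if_neg (Finset.ne_of_mem_erase hj), if_true,
        sub_zero, algebraMap_oddVar, algebraMap_evenVar]
    · intro i j
      simp only [dlog, ← neg_sub (evenVar j) (evenVar i), map_neg, neg_div_neg_eq]
    · intro i j hi hj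
      simp [dlog, pderiv_evenVar, hi, hj]

end GroupAlgebra

/-! ### The Laplace equation of a character -/

section Laplace

open AddMonoidAlgebra
open scoped Matrix

variable {n : ℕ}

lemma sum_erase_inl {ι M : Type*} [Fintype ι] [DecidableEq ι] [AddCommMonoid M] (f : ι ⊕ ι → M)
    (i : ι) : ∑ b ∈ Finset.univ.erase (.inl i), f b =
      f (.inr i) + ∑ j ∈ Finset.univ.erase i, (f (.inl j) + f (.inr j)) := by
  have h : Finset.univ.erase (Sum.inl i : ι ⊕ ι) = (Finset.univ.erase i).disjSum Finset.univ := by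
    ext (b | b) <;> simp
  rw [h, Finset.sum_disjSum, ← Finset.add_sum_erase _ (fun j => f (.inr j)) (Finset.mem_univ i),
    Finset.sum_add_distrib, add_left_comm]

lemma expo_wt_inl (i : Fin n) : expo (wt (.inl i)) = xvar n i := rfl

lemma expo_wt_inr (i : Fin n) : expo (wt (.inr i)) = (xvar n i)⁻¹ := expo_neg _

lemma expo_wt_swap (a : Fin n ⊕ Fin n) : expo (wt a.swap) = (expo (wt a))⁻¹ := by
  rcases a with i | i
  · rw [Sum.swap_inl, expo_wt_inl, expo_wt_inr]
  · rw [Sum.swap_inr, expo_wt_inl, expo_wt_inr, inv_inv]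

lemma wt_injective : Function.Injective (wt (n := n)) := by
  intro a b h
  by_contra hab
  rcases wt_sub_wt_mem_positiveRoots hab with hpos | hpos
  all_goals simpa [h] using dotProduct_rho_pos hpos

lemma expo_wt_sub_ne_zero {a b : Fin n ⊕ Fin n} (hab : a ≠ b) : expo (wt a) - expo (wt b) ≠ 0 :=
  sub_ne_zero.2 fun h => hab (wt_injective (expo_injective h))

lemma sum_swap_involutive {α : Type*} : Function.Involutive (Sum.swap : α ⊕ α → α ⊕ α) :=
  Sum.swap_swap

lemma longFactor_comm (a b : Fin n ⊕ Fin n) : longFactor a b = longFactor b a := by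
  simp only [longFactor, ← sum_swap_involutive.eq_iff (x := b), eq_comm]

lemma longFactor_swap (a b : Fin n ⊕ Fin n) : longFactor a.swap b.swap = longFactor a b := by
  simp only [longFactor, sum_swap_involutive.injective.eq_iff]

/-- The sum of `(x_a + x_b) / (x_a - x_b)` over the roots `ε_a - ε_b` that start at the signed index
`a`, where the long root has weight two. -/
def rootSum (a : Fin n ⊕ Fin n) : Frac n :=
  ∑ b ∈ Finset.univ.erase a,
    longFactor a b * ((expo (wt a) + expo (wt b)) / (expo (wt a) - expo (wt b)))

lemma inv_add_inv_div_inv_sub_inv {F : Type*} [Field F] {x y : F} (hx : x ≠ 0) (hy : y ≠ 0) :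
    (x⁻¹ + y⁻¹) / (x⁻¹ - y⁻¹) = -((x + y) / (x - y)) := by
  rw [inv_add_inv hx hy, inv_sub_inv hx hy, div_div_div_cancel_right₀ (mul_ne_zero hx hy),
    ← neg_sub x y, div_neg]

lemma rootSum_swap (a : Fin n ⊕ Fin n) : rootSum a.swap = -rootSum a := by
  rw [rootSum, rootSum, ← Finset.sum_neg_distrib]
  refine (Finset.sum_equiv (Equiv.sumComm _ _) (fun b => ?_) fun b _ => ?_).symm
  · simp [sum_swap_involutive.injective.eq_iff]
  · rw [Equiv.sumComm_apply, longFactor_swap, expo_wt_swap, expo_wt_swap,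
      inv_add_inv_div_inv_sub_inv (expo_ne_zero _) (expo_ne_zero _), mul_neg]

lemma div_sub_add_div_sub_inv {F : Type*} [Field F] {x y : F} (hx : x ≠ 0) (hy : y ≠ 0)
    (hsub : y - x ≠ 0) (hsub_inv : y - x⁻¹ ≠ 0) :
    (y + x) / (y - x) + (y + x⁻¹) / (y - x⁻¹) =
      2 * ((y - y⁻¹) / (y + y⁻¹ - (x + x⁻¹))) := by
  have hfactor : y + y⁻¹ - (x + x⁻¹) = (y - x) * (y - x⁻¹) * y⁻¹ := by
    field_simp
    ring
  rw [hfactor, div_add_div _ _ hsub hsub_inv, mul_div_assoc',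
    div_eq_div_iff (mul_ne_zero hsub hsub_inv)
      (mul_ne_zero (mul_ne_zero hsub hsub_inv) (inv_ne_zero hy))]
  field_simp
  ring

lemma rootSum_inl (i : Fin n) : rootSum (.inl i) = 2 * dlog i (denomAlg n) := by
  rw [rootSum, sum_erase_inl, dlog_denomAlg, mul_add, Finset.mul_sum]
  congr 1
  · simp [longFactor, expo_wt_inl, expo_wt_inr]
  · refine Finset.sum_congr rfl fun j hj => ?_
    have hji := Finset.ne_of_mem_erase hj
    rw [← div_sub_add_div_sub_inv (xvar_ne_zero j) (xvar_ne_zero i) (xvar_sub_ne_zero hji.symm)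
      (xvar_sub_inv_ne_zero i j)]
    simp [longFactor, expo_wt_inl, expo_wt_inr, hji]

lemma rootSum_inr (i : Fin n) : rootSum (.inr i) = -(2 * dlog i (denomAlg n)) := by
  rw [← rootSum_inl, ← rootSum_swap, Sum.swap_inl]

variable (V : Type) [AddCommGroup V] [Module ℂ V] [LieRingModule (Sp n) V]
  [LieModule ℂ (Sp n) V] [FiniteDimensional ℂ V]

/-- The set of weights of a module. -/
def weights : Finset (Weight n) := (finite_support_mult (n := n) V).toFinset

lemma mem_weights {μ : Weight n} : μ ∈ weights V ↔ mult V μ ≠ 0 := by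
  simp [weights]

/-- The element of the group algebra with given coefficients at the weights of a module. -/
def weightSum (f : Weight n → K) : GroupAlg n := ∑ μ ∈ weights V, single μ (f μ)

lemma coeff_weightSum {f : Weight n → K} (hf : ∀ μ : Weight n, mult V μ = 0 → f μ = 0)
    (μ : Weight n) : (weightSum V f).coeff μ = f μ := by
  classical
  rw [weightSum, coeff_sum, Finsupp.finsetSum_apply]
  simp only [coeff_single, Finsupp.single_apply, Finset.sum_ite_eq']
  split_ifs with h
  · rfl
  · rw [mem_weights, not_not] at h
    exact (hf μ h).symm

/-- The character as an element of the group algebra. -/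
def charAlg : GroupAlg n := weightSum V fun μ => (mult V μ : K)

lemma coeff_charAlg (μ : Weight n) : (charAlg V).coeff μ = mult V μ :=
  coeff_weightSum V (fun μ h => by rw [h, Nat.cast_zero]) μ

lemma character_eq : character (n := n) V = algebraMap (GroupAlg n) (Frac n) (charAlg V) := by
  rw [character, charAlg, weightSum, map_sum, finsum_eq_sum_of_support_subset (s := weights V)]
  · refine Finset.sum_congr rfl fun μ _ => ?_
    have hsingle : (single μ (mult V μ : K) : GroupAlg n) =
        (mult V μ : GroupAlg n) * single μ 1 := by
      rw [natCast_def, single_mul_single]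
      simp
    rw [hsingle, map_mul, map_natCast]
    rfl
  · intro μ hμ
    rw [Finset.mem_coe, mem_weights]
    refine fun h => hμ ?_
    change ((mult V μ : ℕ) : Frac n) * _ = 0
    rw [h, Nat.cast_zero, zero_mul]

/-- The generating function of the traces `loopTrace V a b`. -/
def loopAlg (a b : Fin n ⊕ Fin n) : GroupAlg n :=
  weightSum V fun μ => algebraMap ℂ K (loopTrace V a b μ)

lemma coeff_loopAlg (a b : Fin n ⊕ Fin n) (μ : Weight n) :
    (loopAlg V a b).coeff μ = algebraMap ℂ K (loopTrace V a b μ) :=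
  coeff_weightSum V (fun μ h => by rw [loopTrace_eq_zero V h, map_zero]) μ

lemma loopAlg_comm (a b : Fin n ⊕ Fin n) :
    loopAlg V a b = single (wt a - wt b) 1 * loopAlg V b a := by
  ext μ
  rw [coeff_single_mul_apply, coeff_loopAlg, coeff_loopAlg, one_mul, loopTrace_comm]
  congr 3
  abel

/-- The derivative of the character in the direction of a signed index. -/
def charDeriv (a : Fin n ⊕ Fin n) : GroupAlg n := scale (fun μ => (coord μ a : K)) (charAlg V)

lemma charDeriv_inl (i : Fin n) : charDeriv V (.inl i) = pderiv i (charAlg V) := rfl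

lemma charDeriv_inr (i : Fin n) : charDeriv V (.inr i) = -pderiv i (charAlg V) := by
  ext μ
  simp [charDeriv, pderiv, coeff_scale, coord]

lemma loopAlg_sub {a b : Fin n ⊕ Fin n} (hab : a ≠ b) :
    loopAlg V a b - loopAlg V b a =
      (longFactor a b : GroupAlg n) * (charDeriv V a - charDeriv V b) := by
  ext μ
  rw [coeff_sub, Finsupp.sub_apply, coeff_loopAlg, coeff_loopAlg, ← map_sub, loopTrace_sub V hab,
    intCast_def, coeff_single_mul_apply]
  simp only [neg_zero, zero_add, coeff_sub, Finsupp.sub_apply, charDeriv, coeff_scale,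
    coeff_charAlg, map_mul, map_intCast, map_natCast]
  push_cast
  ring

lemma algebraMap_loopAlg {a b : Fin n ⊕ Fin n} (hab : a ≠ b) :
    algebraMap (GroupAlg n) (Frac n) (loopAlg V a b) = longFactor a b *
      (expo (wt a) / (expo (wt a) - expo (wt b))) *
        (algebraMap _ _ (charDeriv V a) - algebraMap _ _ (charDeriv V b)) := by
  have hcomm : algebraMap (GroupAlg n) (Frac n) (loopAlg V b a) =
      expo (wt b) / expo (wt a) * algebraMap (GroupAlg n) (Frac n) (loopAlg V a b) := by
    rw [loopAlg_comm V b a, map_mul, ← expo_sub]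
    rfl
  have hsub := congrArg (algebraMap (GroupAlg n) (Frac n)) (loopAlg_sub V hab)
  rw [map_sub, map_mul, map_intCast, map_sub, hcomm] at hsub
  have hne := expo_wt_sub_ne_zero hab
  have ha := expo_ne_zero (wt a)
  rw [mul_right_comm, ← hsub]
  field_simp

lemma sum_sum_erase_comm {ι M : Type*} [Fintype ι] [DecidableEq ι] [AddCommMonoid M]
    (f : ι → ι → M) :
    ∑ a, ∑ b ∈ Finset.univ.erase a, f a b = ∑ a, ∑ b ∈ Finset.univ.erase a, f b a :=
  Finset.sum_comm' (by simp [eq_comm])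

lemma sum_loopAlg_eq_sum_rootSum :
    ∑ a : Fin n ⊕ Fin n, ∑ b ∈ Finset.univ.erase a,
      algebraMap (GroupAlg n) (Frac n) (loopAlg V a b) =
        ∑ a, rootSum a * algebraMap _ _ (charDeriv V a) := by
  let d (a : Fin n ⊕ Fin n) : Frac n := algebraMap (GroupAlg n) (Frac n) (charDeriv V a)
  let c (a b : Fin n ⊕ Fin n) : Frac n :=
    longFactor a b * (expo (wt a) / (expo (wt a) - expo (wt b)))
  have hc (a b : Fin n ⊕ Fin n) : c a b - c b a =
      longFactor a b * ((expo (wt a) + expo (wt b)) / (expo (wt a) - expo (wt b))) := by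
    simp only [c]
    rw [longFactor_comm b a, ← neg_sub (expo (wt a)), div_neg]
    ring
  calc ∑ a : Fin n ⊕ Fin n, ∑ b ∈ Finset.univ.erase a,
        algebraMap (GroupAlg n) (Frac n) (loopAlg V a b)
      = ∑ a, ∑ b ∈ Finset.univ.erase a, (c a b * d a - c a b * d b) :=
        Finset.sum_congr rfl fun a _ => Finset.sum_congr rfl fun b hb => by
          rw [algebraMap_loopAlg V (Finset.ne_of_mem_erase hb).symm, mul_sub]
    _ = ∑ a, ∑ b ∈ Finset.univ.erase a, (c a b - c b a) * d a := by
        simp only [sub_mul, Finset.sum_sub_distrib]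
        rw [sum_sum_erase_comm fun a b => c a b * d b]
    _ = ∑ a, rootSum a * d a := by simp only [hc, rootSum, Finset.sum_mul]

lemma sum_loopAlg_offDiag :
    ∑ a : Fin n ⊕ Fin n, ∑ b ∈ Finset.univ.erase a,
      algebraMap (GroupAlg n) (Frac n) (loopAlg V a b) =
        4 * ∑ i, dlog i (denomAlg n) * algebraMap _ _ (pderiv i (charAlg V)) := by
  rw [sum_loopAlg_eq_sum_rootSum, Fintype.sum_sum_type, Finset.mul_sum, ← Finset.sum_add_distrib]
  refine Finset.sum_congr rfl fun i _ => ?_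
  rw [rootSum_inl, rootSum_inr, charDeriv_inl, charDeriv_inr, map_neg]
  ring

lemma sum_loopAlg_diag :
    ∑ a : Fin n ⊕ Fin n, loopAlg V a a = 2 * laplacian (charAlg V) := by
  ext μ
  rw [coeff_sum, Finsupp.finsetSum_apply, two_mul, coeff_add, Finsupp.add_apply, laplacian,
    coeff_scale, coeff_charAlg, Fintype.sum_sum_type]
  simp only [coeff_loopAlg, loopTrace_self, map_mul, map_intCast, map_natCast, ← Finset.sum_mul,
    coord, Sum.elim_inl, Sum.elim_inr, neg_sq, dotProduct]
  push_cast
  simp only [sq]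

lemma sum_loopAlg {c : ℂ} (hc : ∀ v : V, casimir n V v = c • v) :
    ∑ a : Fin n ⊕ Fin n, ∑ b, loopAlg V a b =
      algebraMap K (GroupAlg n) (algebraMap ℂ K c) * charAlg V := by
  ext μ
  simp only [coeff_sum, Finsupp.finsetSum_apply, coeff_loopAlg, ← map_sum, sum_loopTrace V hc]
  rw [← Algebra.smul_def, coeff_smul_apply, coeff_charAlg, map_mul, map_natCast, smul_eq_mul]

lemma denomAlg_mul_sum_loopAlg_offDiag :
    denomAlg n * ∑ a : Fin n ⊕ Fin n, ∑ b ∈ Finset.univ.erase a, loopAlg V a b =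
      4 * ∑ i, pderiv i (denomAlg n) * pderiv i (charAlg V) := by
  apply IsFractionRing.injective (GroupAlg n) (Frac n)
  simp only [map_mul, map_sum, map_ofNat]
  rw [sum_loopAlg_offDiag, mul_left_comm, Finset.mul_sum]
  simp only [← mul_assoc, algebraMap_pderiv denomAlg_ne_zero]

-- Twice the cross term of the Laplacian of a product is the off-diagonal part of the trace of the
-- Casimir operator, which leaves a scalar.
lemma laplacian_denomAlg_mul_charAlg {c : ℂ} (hc : ∀ v : V, casimir n V v = c • v)
    {r : K} (hr : laplacian (denomAlg n) = r • denomAlg n) :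
    laplacian (denomAlg n * charAlg V) =
      (algebraMap ℂ K c / 2 + r) • (denomAlg n * charAlg V) := by
  have hsplit : ∑ a : Fin n ⊕ Fin n, ∑ b, loopAlg V a b =
      2 * laplacian (charAlg V) +
        ∑ a : Fin n ⊕ Fin n, ∑ b ∈ Finset.univ.erase a, loopAlg V a b := by
    rw [← sum_loopAlg_diag, ← Finset.sum_add_distrib]
    exact Finset.sum_congr rfl fun a _ => (Finset.add_sum_erase _ _ (Finset.mem_univ a)).symm
  have hmul := congrArg (denomAlg n * ·) (hsplit.symm.trans (sum_loopAlg V hc))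
  simp only [mul_add, denomAlg_mul_sum_loopAlg_offDiag] at hmul
  have htwo : algebraMap K (GroupAlg n) 2⁻¹ * 2 = 1 := by
    rw [← map_ofNat (algebraMap K (GroupAlg n)) 2, ← map_mul, inv_mul_cancel₀ two_ne_zero, map_one]
  rw [laplacian_mul, hr, Algebra.smul_def, Algebra.smul_def, map_add, div_eq_mul_inv, map_mul]
  linear_combination algebraMap K (GroupAlg n) 2⁻¹ * hmul -
    (denomAlg n * laplacian (charAlg V) +
      2 * ∑ i, pderiv i (denomAlg n) * pderiv i (charAlg V)) * htwo

end Laplace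

/-! ### The Weyl character formula -/

section CharacterFormula

open AddMonoidAlgebra
open scoped Matrix

variable {n : ℕ}

/-- The action on weights of the signed permutation `(σ, s)`, an element of the Weyl group. -/
def signedPerm (σ : Equiv.Perm (Fin n)) (s : Fin n → ℤˣ) : Weight n ≃ Weight n where
  toFun μ i := (s i : ℤ) * μ (σ i)
  invFun μ i := (s (σ.symm i) : ℤ) * μ (σ.symm i)
  left_inv μ := by
    ext i
    simp only [Equiv.apply_symm_apply, ← mul_assoc, Int.units_coe_mul_self, one_mul]
  right_inv μ := by
    ext i
    simp only [Equiv.symm_apply_apply, ← mul_assoc, Int.units_coe_mul_self, one_mul]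

lemma signedPerm_apply (σ : Equiv.Perm (Fin n)) (s : Fin n → ℤˣ) (μ : Weight n) (i : Fin n) :
    signedPerm σ s μ i = (s i : ℤ) * μ (σ i) := rfl

lemma signedPerm_add (σ : Equiv.Perm (Fin n)) (s : Fin n → ℤˣ) (μ ν : Weight n) :
    signedPerm σ s (μ + ν) = signedPerm σ s μ + signedPerm σ s ν := by
  ext i
  simp [signedPerm_apply, mul_add]

lemma signedPerm_dotProduct_self (σ : Equiv.Perm (Fin n)) (s : Fin n → ℤˣ) (μ : Weight n) :
    signedPerm σ s μ ⬝ᵥ signedPerm σ s μ = μ ⬝ᵥ μ := by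
  simp only [dotProduct, signedPerm_apply]
  rw [← Equiv.sum_comp σ fun i => μ i * μ i]
  refine Finset.sum_congr rfl fun i _ => ?_
  rw [mul_mul_mul_comm, Int.units_coe_mul_self, one_mul]

lemma exists_signedPerm_isDominant (μ : Weight n) : ∃ σ s, IsDominant (signedPerm σ s μ) := by
  let σ := Tuple.sort fun i => -|μ i|
  have hσ : Monotone ((fun i => -|μ i|) ∘ σ) := Tuple.monotone_sort _
  refine ⟨σ, fun i => if 0 ≤ μ (σ i) then 1 else -1, ?_⟩
  have habs : ∀ i, signedPerm σ (fun i => if 0 ≤ μ (σ i) then 1 else -1) μ i = |μ (σ i)| := by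
    intro i
    rw [signedPerm_apply]
    split_ifs with hi
    · simp [abs_of_nonneg hi]
    · simp [abs_of_neg (not_le.1 hi)]
  refine ⟨fun i j hij => ?_, fun i => ?_⟩
  · rw [habs, habs]
    exact neg_le_neg_iff.1 (hσ hij)
  · exact (habs i).symm ▸ abs_nonneg _

/-- The determinant of the signed permutation `(σ, s)`. -/
def signOf (σ : Equiv.Perm (Fin n)) (s : Fin n → ℤˣ) : ℤ := σ.sign * ∏ i, (s i : ℤ)

/-- The alternating sum `∑_w (det w) e^{wν}` over the Weyl group, in the group algebra. -/
def altAlg (ν : Weight n) : GroupAlg n :=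
  ∑ σ : Equiv.Perm (Fin n), ∑ s : Fin n → ℤˣ, single (signedPerm σ s ν) (signOf σ s : K)

lemma single_intCast (μ : Weight n) (c : ℤ) :
    (single μ (c : K) : GroupAlg n) = (c : GroupAlg n) * single μ 1 := by
  rw [intCast_def, single_mul_single, zero_add, mul_one]

lemma expo_sum {ι : Type*} (S : Finset ι) (μ : ι → Weight n) :
    expo (∑ i ∈ S, μ i) = ∏ i ∈ S, expo (μ i) := by
  induction S using Finset.cons_induction with
  | empty => exact expo_zero
  | cons i S hi ih => rw [Finset.sum_cons, Finset.prod_cons, expo_add, ih]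

lemma expo_eq_prod (μ : Weight n) : expo μ = ∏ i, xvar n i ^ μ i := by
  have hsum : μ = ∑ i, μ i • eps i := by
    ext j
    simp [eps, Finset.sum_apply, Pi.single_apply]
  conv_lhs => rw [hsum, expo_sum]
  simp only [expo_zsmul, xvar]

lemma algebraMap_altAlg (ν : Weight n) :
    algebraMap (GroupAlg n) (Frac n) (altAlg ν) = alternant (xvar n) ν := by
  have hodd : ∀ i j, altMatrix (xvar n) ν i j =
      ∑ s : ℤˣ, ((s : ℤ) : Frac n) * xvar n i ^ ((s : ℤ) * ν j) := by
    intro i j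
    rw [UnitsInt.univ, Finset.sum_pair (by decide)]
    simp only [altMatrix, oddPow, Matrix.of_apply, Units.val_one, Int.cast_one, one_mul,
      Units.val_neg, Int.cast_neg, neg_mul, zpow_neg, sub_eq_add_neg]
  rw [alternant, ← Matrix.det_transpose, Matrix.det_apply', altAlg, map_sum]
  refine Finset.sum_congr rfl fun σ _ => ?_
  simp only [Matrix.transpose_apply, hodd]
  rw [map_sum, Finset.prod_univ_sum, Fintype.piFinset_univ, Finset.mul_sum]
  refine Finset.sum_congr rfl fun s _ => ?_
  rw [single_intCast, map_mul, map_intCast]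
  change _ * expo _ = _
  rw [expo_eq_prod, Finset.prod_mul_distrib, signOf]
  push_cast
  rw [mul_assoc]
  rfl

lemma denomAlg_eq_altAlg : denomAlg n = altAlg (rho n) := by
  apply IsFractionRing.injective (GroupAlg n) (Frac n)
  rw [algebraMap_denomAlg, algebraMap_altAlg, weylDenom_eq_alternant _ xvar_ne_zero]

lemma laplacian_altAlg (ν : Weight n) :
    laplacian (altAlg ν) = ((ν ⬝ᵥ ν : ℤ) : K) • altAlg ν := by
  simp only [altAlg, map_sum, Finset.smul_sum]
  refine Finset.sum_congr rfl fun σ _ => Finset.sum_congr rfl fun s _ => ?_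
  rw [laplacian, scale_single, signedPerm_dotProduct_self, smul_single, smul_eq_mul]

lemma dotProduct_self_of_laplacian_eq_smul {f : GroupAlg n} {c : K} (hf : laplacian f = c • f)
    {ν : Weight n} (hν : f.coeff ν ≠ 0) : ((ν ⬝ᵥ ν : ℤ) : K) = c := by
  have hcoeff := congrArg (fun g : GroupAlg n => g.coeff ν) hf
  simp only [laplacian, coeff_scale, coeff_smul_apply, smul_eq_mul] at hcoeff
  exact mul_right_cancel₀ hν hcoeff

lemma coeff_altAlg_eq_zero {ν ν' : Weight n} (h : ν' ⬝ᵥ ν' ≠ ν ⬝ᵥ ν) :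
    (altAlg ν).coeff ν' = 0 := by
  contrapose! h
  exact_mod_cast dotProduct_self_of_laplacian_eq_smul (laplacian_altAlg ν) h

lemma signedPerm_eq_self_iff {ν : Weight n} (hanti : StrictAnti ν) (hpos : ∀ i, 0 < ν i)
    {σ : Equiv.Perm (Fin n)} {s : Fin n → ℤˣ} : signedPerm σ s ν = ν ↔ σ = 1 ∧ s = 1 := by
  refine ⟨fun h => ?_, ?_⟩
  · have happly : ∀ i, (s i : ℤ) * ν (σ i) = ν i := congrFun h
    have hs : s = 1 := by
      funext i
      refine (Int.units_eq_one_or (s i)).resolve_right fun hneg => ?_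
      have hi := happly i
      rw [hneg, Units.val_neg, Units.val_one, neg_one_mul] at hi
      linarith [hpos i, hpos (σ i)]
    refine ⟨Equiv.ext fun i => hanti.injective ?_, hs⟩
    simpa [hs] using happly i
  · rintro ⟨rfl, rfl⟩
    ext i
    simp [signedPerm_apply]

lemma coeff_altAlg_self {ν : Weight n} (hanti : StrictAnti ν) (hpos : ∀ i, 0 < ν i) :
    (altAlg ν).coeff ν = 1 := by
  have hcoeff : ∀ σ s, (single (signedPerm σ s ν) (signOf σ s : K) : GroupAlg n).coeff ν =
      if σ = 1 ∧ s = 1 then 1 else 0 := by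
    intro σ s
    rw [coeff_single, Finsupp.single_apply]
    refine if_ctx_congr (signedPerm_eq_self_iff hanti hpos) ?_ fun _ => rfl
    rintro ⟨rfl, rfl⟩
    simp [signOf]
  simp only [altAlg, coeff_sum, Finsupp.finsetSum_apply, hcoeff, ite_and, Finset.sum_ite_irrel,
    Finset.sum_const_zero, Finset.sum_ite_eq', Finset.mem_univ, if_true]

lemma rho_strictAnti : StrictAnti (rho n) := by
  intro i j hij
  have : (i : ℕ) < j := hij
  simp only [rho]
  lia

lemma rho_pos (i : Fin n) : 0 < rho n i := by
  have := i.2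
  simp only [rho]
  lia

variable {V : Type} [AddCommGroup V] [Module ℂ V] [LieRingModule (Sp n) V]
  [LieModule ℂ (Sp n) V] [FiniteDimensional ℂ V]

lemma mult_signedPerm (σ : Equiv.Perm (Fin n)) (s : Fin n → ℤˣ) (μ : Weight n) :
    mult V (signedPerm σ s μ) = mult V μ :=
  (mult_units_mul s (μ ∘ σ)).trans (mult_comp_perm σ μ)

variable (V) in
lemma denomAlg_mul_charAlg :
    denomAlg n * charAlg V = ∑ μ ∈ weights V, (mult V μ : GroupAlg n) * altAlg (μ + rho n) := by
  have hinvariant : ∀ σ s, charAlg (n := n) V =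
      ∑ μ ∈ weights V, single (signedPerm σ s μ) (mult V μ : K) := fun σ s =>
    (Finset.sum_equiv (signedPerm σ s) (fun μ => by rw [mem_weights, mem_weights, mult_signedPerm])
      fun μ _ => by simp only [mult_signedPerm]).symm
  simp only [denomAlg_eq_altAlg, altAlg, Finset.mul_sum, Finset.sum_mul]
  rw [Finset.sum_comm (s := weights V)]
  refine Finset.sum_congr rfl fun σ _ => ?_
  rw [Finset.sum_comm (s := weights V)]
  refine Finset.sum_congr rfl fun s _ => ?_
  rw [hinvariant σ s, Finset.mul_sum]
  refine Finset.sum_congr rfl fun μ _ => ?_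
  rw [single_mul_single, natCast_def, single_mul_single, zero_add, signedPerm_add, add_comm,
    mul_comm]

variable [LieModule.IsIrreducible ℂ (Sp n) V]

lemma dotProduct_add_rho_lt {lam : Weight n} {v : V} (hv : IsHighestWeightVector V lam v)
    (hlam : IsDominant lam) {μ : Weight n} (hμ : mult V μ ≠ 0) (hne : μ ≠ lam) :
    (μ + rho n) ⬝ᵥ (μ + rho n) < (lam + rho n) ⬝ᵥ (lam + rho n) := by
  obtain ⟨σ, s, hdom⟩ := exists_signedPerm_isDominant μ
  set μ' := signedPerm σ s μ
  have hle : ∀ t, IsDominant t → μ' ⬝ᵥ t ≤ lam ⬝ᵥ t := by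
    intro t ht
    by_cases h : μ' = lam
    · rw [h]
    · exact (isBelow_of_mult_ne_zero hv ((mult_signedPerm σ s μ).trans_ne hμ) h).1 t ht
  have hnorm : μ ⬝ᵥ μ ≤ lam ⬝ᵥ lam :=
    calc μ ⬝ᵥ μ = μ' ⬝ᵥ μ' := (signedPerm_dotProduct_self σ s μ).symm
      _ ≤ lam ⬝ᵥ μ' := hle _ hdom
      _ = μ' ⬝ᵥ lam := dotProduct_comm _ _
      _ ≤ lam ⬝ᵥ lam := hle _ hlam
  have hrho := (isBelow_of_mult_ne_zero hv hμ hne).2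
  simp only [add_dotProduct, dotProduct_add, dotProduct_comm (rho n) _]
  linarith

lemma coeff_denomAlg_mul_charAlg {lam : Weight n} {v : V} (hv : IsHighestWeightVector V lam v)
    (hlam : IsDominant lam) {ν : Weight n} (hν : ν ⬝ᵥ ν = (lam + rho n) ⬝ᵥ (lam + rho n)) :
    (denomAlg n * charAlg V).coeff ν = (altAlg (lam + rho n)).coeff ν := by
  rw [denomAlg_mul_charAlg, coeff_sum, Finsupp.finsetSum_apply, Finset.sum_eq_single lam]
  · rw [mult_highestWeight hv, Nat.cast_one, one_mul]
  · intro μ hμ hne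
    have hlt := dotProduct_add_rho_lt hv hlam ((mem_weights V).1 hμ) hne
    rw [natCast_def, coeff_single_mul_apply, neg_zero, zero_add,
      coeff_altAlg_eq_zero (by rw [hν]; exact hlt.ne'), mul_zero]
  · intro hmem
    rw [mem_weights, not_not, mult_highestWeight hv] at hmem
    exact absurd hmem one_ne_zero

/-- By `laplacian_denomAlg_mul_charAlg` the left side is supported on a sphere, which passes through
`lam + rho n`; of the alternants in `denomAlg_mul_charAlg` only that of `lam + rho n` meets it. -/
lemma denomAlg_mul_charAlg_eq_altAlg {lam : Weight n} {v : V}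
    (hv : IsHighestWeightVector V lam v) (hlam : IsDominant lam) :
    denomAlg n * charAlg V = altAlg (lam + rho n) := by
  obtain ⟨c, hc⟩ := exists_casimir_eq_smul n V
  have heigen := laplacian_denomAlg_mul_charAlg V hc (by rw [denomAlg_eq_altAlg, laplacian_altAlg])
  have hone : (denomAlg n * charAlg V).coeff (lam + rho n) = 1 := by
    rw [coeff_denomAlg_mul_charAlg hv hlam rfl]
    exact coeff_altAlg_self
      (fun i j hij => add_lt_add_of_le_of_lt (hlam.1 hij.le) (rho_strictAnti hij))
      fun i => add_pos_of_nonneg_of_pos (hlam.2 i) (rho_pos i)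
  have hsphere := dotProduct_self_of_laplacian_eq_smul heigen (hone.trans_ne one_ne_zero)
  ext ν
  by_cases hν : ν ⬝ᵥ ν = (lam + rho n) ⬝ᵥ (lam + rho n)
  · exact coeff_denomAlg_mul_charAlg hv hlam hν
  · rw [coeff_altAlg_eq_zero hν]
    contrapose! hν
    exact_mod_cast (dotProduct_self_of_laplacian_eq_smul heigen hν).trans hsphere.symm

theorem weylDenom_mul_character {lam : Weight n} {v : V} (hv : IsHighestWeightVector V lam v)
    (hlam : IsDominant lam) :
    weylDenom (xvar n) * character (n := n) V = alternant (xvar n) (lam + rho n) := by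
  rw [character_eq, ← algebraMap_denomAlg, ← map_mul, denomAlg_mul_charAlg_eq_altAlg hv hlam,
    algebraMap_altAlg]

end CharacterFormula

/-! ### Existence of simple modules with dominant highest weights -/

section SimpleSubquotient

lemma isIrreducible_quotient_of_isCoatom {R L M : Type*} [CommRing R] [LieRing L] [LieAlgebra R L]
    [AddCommGroup M] [Module R M] [LieRingModule L M] [LieModule R L M] {N : LieSubmodule R L M}
    (hN : IsCoatom N) : LieModule.IsIrreducible R L (M ⧸ N) := by
  have hsurj := LieSubmodule.Quotient.surjective_mk' N
  have hnontrivial : Nontrivial (M ⧸ N) := by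
    obtain ⟨v, hv⟩ : ∃ v, v ∉ N := by
      by_contra! hall
      exact hN.1 (eq_top_iff.2 fun v _ => hall v)
    exact ⟨⟨_, 0, mt (LieSubmodule.Quotient.mk_eq_zero N).1 hv⟩⟩
  refine LieModule.IsIrreducible.mk fun S hS => ?_
  have hle : N ≤ S.comap (LieSubmodule.Quotient.mk' N) := fun v hv => by
    rw [LieSubmodule.mem_comap, (LieSubmodule.Quotient.mk_eq_zero N).2 hv]
    exact zero_mem S
  have htop : S.comap (LieSubmodule.Quotient.mk' N) = ⊤ := by
    refine hN.2 _ (hle.lt_of_ne fun heq => hS (eq_bot_iff.2 fun w hw => ?_))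
    obtain ⟨v, rfl⟩ := hsurj w
    have hv : v ∈ S.comap (LieSubmodule.Quotient.mk' N) := hw
    rw [← heq] at hv
    exact (LieSubmodule.Quotient.mk_eq_zero N).2 hv
  refine eq_top_iff.2 fun w _ => ?_
  obtain ⟨v, rfl⟩ := hsurj w
  have hv : v ∈ S.comap (LieSubmodule.Quotient.mk' N) := htop ▸ LieSubmodule.mem_top v
  exact hv

lemma lieSpan_singleton_eq_top_of_mem {R L M : Type*} [CommRing R] [LieRing L]
    [AddCommGroup M] [Module R M] [LieRingModule L M] {v : M}
    {T : LieSubmodule R L (LieSubmodule.lieSpan R L {v})}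
    (hT : ⟨v, LieSubmodule.subset_lieSpan rfl⟩ ∈ T) : T = ⊤ := by
  have hle : LieSubmodule.lieSpan R L {v} ≤ T.map (LieSubmodule.lieSpan R L {v}).incl :=
    LieSubmodule.lieSpan_le.2 (Set.singleton_subset_iff.2 (LieSubmodule.mem_map_of_mem hT))
  refine eq_top_iff.2 fun w _ => ?_
  obtain ⟨u, hu, huw⟩ := (LieSubmodule.mem_map _).1 (hle w.2)
  rwa [← Subtype.ext huw]

variable {n : ℕ} {M M' : Type} [AddCommGroup M] [Module ℂ M] [LieRingModule (Sp n) M]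
  [LieModule ℂ (Sp n) M] [AddCommGroup M'] [Module ℂ M'] [LieRingModule (Sp n) M']
  [LieModule ℂ (Sp n) M']

lemma IsHighestWeightVector.map {lam : Weight n} {v : M} (hv : IsHighestWeightVector M lam v)
    (f : M →ₗ⁅ℂ,Sp n⁆ M') (hf : f v ≠ 0) : IsHighestWeightVector M' lam (f v) := by
  refine ⟨hf, mem_weightSpace.2 fun h => ?_, fun α hα x hx => ?_⟩
  · rw [← LieModuleHom.map_lie, mem_weightSpace.1 hv.2.1, map_smul]
  · rw [← LieModuleHom.map_lie, hv.2.2 α hα x hx, map_zero]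

lemma IsHighestWeightVector.of_map {lam : Weight n} {v : M} (f : M →ₗ⁅ℂ,Sp n⁆ M')
    (hf : Function.Injective f) (hv : IsHighestWeightVector M' lam (f v)) :
    IsHighestWeightVector M lam v := by
  refine ⟨fun h => hv.1 (by rw [h, map_zero]), mem_weightSpace.2 fun h => hf ?_,
    fun α hα x hx => hf ?_⟩
  · rw [LieModuleHom.map_lie, mem_weightSpace.1 hv.2.1, map_smul]
  · rw [LieModuleHom.map_lie, hv.2.2 α hα x hx, map_zero]

/-- The simple module is a quotient of the submodule generated by the highest weight vector. -/
theorem nonempty_simpleModule [FiniteDimensional ℂ M] {lam : Weight n} {v : M}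
    (hv : IsHighestWeightVector M lam v) : Nonempty (SimpleModuleOfHighestWeight n lam) := by
  let N : LieSubmodule ℂ (Sp n) M := LieSubmodule.lieSpan ℂ (Sp n) {v}
  let v' : N := ⟨v, LieSubmodule.subset_lieSpan rfl⟩
  have hv' : IsHighestWeightVector N lam v' := hv.of_map N.incl N.injective_incl
  have hbot : (⊥ : LieSubmodule ℂ (Sp n) N) ≠ ⊤ := fun h =>
    hv'.1 ((LieSubmodule.mem_bot v').1 (h ▸ LieSubmodule.mem_top v'))
  obtain ⟨T, hT, -⟩ := (eq_top_or_exists_le_coatom (⊥ : LieSubmodule ℂ (Sp n) N)).resolve_left hbot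
  have hne : LieSubmodule.Quotient.mk' T v' ≠ 0 := fun h =>
    hT.1 (lieSpan_singleton_eq_top_of_mem ((LieSubmodule.Quotient.mk_eq_zero T).1 h))
  exact ⟨{
    carrier := N ⧸ T
    finiteDimensional := inferInstanceAs (FiniteDimensional ℂ (N.toSubmodule ⧸ T.toSubmodule))
    irreducible := isIrreducible_quotient_of_isCoatom hT
    exists_highestWeightVector := ⟨_, hv'.map (LieSubmodule.Quotient.mk' T) hne⟩ }⟩

end SimpleSubquotient

section Derivations

lemma derivation_prod {R A M ι : Type*} [CommSemiring R] [CommSemiring A] [AddCommMonoid M]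
    [Algebra R A] [Module A M] [Module R M] [DecidableEq ι] (D : Derivation R A M) (S : Finset ι)
    (f : ι → A) : D (∏ i ∈ S, f i) = ∑ i ∈ S, (∏ j ∈ S.erase i, f j) • D (f i) := by
  induction S using Finset.induction_on with
  | empty => simp
  | insert i S hi ih =>
    rw [Finset.prod_insert hi, Derivation.leibniz, ih, Finset.sum_insert hi, Finset.erase_insert hi,
      Finset.smul_sum, add_comm]
    congr 1
    refine Finset.sum_congr rfl fun j hj => ?_
    have hij : i ≠ j := fun h => hi (h ▸ hj)
    rw [Finset.erase_insert_of_ne hij, smul_smul,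
      Finset.prod_insert fun h => hi (Finset.mem_of_mem_erase h)]

lemma derivation_det {R A m : Type*} [CommSemiring R] [CommRing A] [Algebra R A] [DecidableEq m]
    [Fintype m] (D : Derivation R A A) (B : Matrix m m A) :
    D B.det = ∑ i, (B.updateCol i fun r => D (B r i)).det := by
  simp only [Matrix.det_apply, map_sum]
  rw [Finset.sum_comm]
  refine Finset.sum_congr rfl fun σ _ => ?_
  rw [Units.smul_def, map_zsmul, derivation_prod, Finset.smul_sum]
  refine Finset.sum_congr rfl fun i _ => ?_
  rw [← Finset.mul_prod_erase Finset.univ (fun j => B.updateCol i _ (σ j) j) (Finset.mem_univ i),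
    Matrix.updateCol_self, Units.smul_def, smul_eq_mul, mul_comm]
  congr 2
  exact Finset.prod_congr rfl fun j hj => by rw [Matrix.updateCol_ne (Finset.ne_of_mem_erase hj)]

open MvPolynomial

lemma isHomogeneous_derivation {σ R : Type*} [CommSemiring R]
    {D : Derivation R (MvPolynomial σ R) (MvPolynomial σ R)}
    (hD : ∀ i, (D (X i)).IsHomogeneous 1) {d : ℕ} {f : MvPolynomial σ R}
    (hf : f.IsHomogeneous d) : (D f).IsHomogeneous d := by
  rw [← mem_homogeneousSubmodule, ← homogeneousSubmodule_one_pow] at hf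
  induction d generalizing f with
  | zero =>
    rw [pow_zero, Submodule.mem_one] at hf
    obtain ⟨c, rfl⟩ := hf
    rw [Derivation.map_algebraMap]
    exact isHomogeneous_zero _ _ 0
  | succ d ih =>
    have hlinear : ∀ g ∈ homogeneousSubmodule σ R 1, (D g).IsHomogeneous 1 := by
      have hle : homogeneousSubmodule σ R 1 ≤
          (homogeneousSubmodule σ R 1).comap (D : MvPolynomial σ R →ₗ[R] MvPolynomial σ R) := by
        conv_lhs => rw [homogeneousSubmodule_one_eq_span_X]
        exact Submodule.span_le.2 (Set.range_subset_iff.2 hD)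
      exact fun g hg => hle hg
    rw [pow_succ] at hf
    induction hf using Submodule.mul_induction_on' with
    | mem_mul_mem f hf g hg =>
      have hf' : f.IsHomogeneous d := by
        rwa [homogeneousSubmodule_one_pow] at hf
      rw [Derivation.leibniz, smul_eq_mul, smul_eq_mul, mul_comm g]
      exact (hf'.mul (hlinear g hg)).add ((ih hf).mul hg)
    | add f _ g _ hf hg =>
      rw [map_add]
      exact hf.add hg

lemma isHomogeneous_det {σ R m : Type*} [CommRing R] [Fintype m] [DecidableEq m] {d : ℕ}
    {B : Matrix m m (MvPolynomial σ R)} (hB : ∀ i j, (B i j).IsHomogeneous d) :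
    B.det.IsHomogeneous (Fintype.card m * d) := by
  rw [Matrix.det_apply]
  refine IsHomogeneous.sum _ _ _ fun σ _ => ?_
  rw [Units.smul_def]
  refine (homogeneousSubmodule _ R _).toAddSubgroup.zsmul_mem ?_ _
  simpa using IsHomogeneous.prod Finset.univ (fun i => B (σ i) i) (fun _ => d) fun i _ => hB _ _

end Derivations

section PolynomialModule

open MvPolynomial

section GeneralLinear

variable {R ι : Type*} (κ : Type*) [CommRing R] [Fintype ι]

/-- The action of a matrix on the polynomial functions of a family, indexed by `κ`, of covectors. -/
def polyDeriv (x : Matrix ι ι R) :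
    Derivation R (MvPolynomial (ι × κ) R) (MvPolynomial (ι × κ) R) :=
  mkDerivation R fun p => ∑ b, x b p.1 • X (b, p.2)

variable {κ} in
lemma polyDeriv_X (x : Matrix ι ι R) (a : ι) (j : κ) :
    polyDeriv κ x (X (a, j)) = ∑ b, x b a • X (b, j) := mkDerivation_X _ _ _

/-- The representation of `𝔤𝔩(ι)` by the derivations `polyDeriv`. -/
def polyRep [DecidableEq ι] :
    Matrix ι ι R →ₗ⁅R⁆ Derivation R (MvPolynomial (ι × κ) R) (MvPolynomial (ι × κ) R) where
  toFun := polyDeriv κ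
  map_add' x y := by
    refine derivation_ext fun ⟨a, j⟩ => ?_
    simp only [Derivation.add_apply, polyDeriv_X, Matrix.add_apply, add_smul,
      Finset.sum_add_distrib]
  map_smul' c x := by
    refine derivation_ext fun ⟨a, j⟩ => ?_
    simp only [Derivation.smul_apply, polyDeriv_X, Matrix.smul_apply, smul_eq_mul, mul_smul,
      Finset.smul_sum, RingHom.id_apply]
  map_lie' {x y} := by
    refine derivation_ext fun ⟨a, j⟩ => ?_
    simp only [Derivation.commutator_apply, polyDeriv_X, map_sum, Derivation.map_smul,
      Ring.lie_def, Matrix.sub_apply, Matrix.mul_apply, sub_smul, Finset.sum_smul, Finset.smul_sum,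
      Finset.sum_sub_distrib, smul_smul]
    congr 1 <;> rw [Finset.sum_comm] <;>
      exact Finset.sum_congr rfl fun c _ => Finset.sum_congr rfl fun b _ => by rw [mul_comm]

end GeneralLinear

variable {n : ℕ}

/-- The polynomial functions on `n`-tuples of covectors, in which a highest weight vector of every
dominant weight is found. -/
abbrev Poly (n : ℕ) : Type := MvPolynomial ((Fin n ⊕ Fin n) × Fin n) ℂ

instance : LieRingModule (Sp n) (Poly n) :=
  LieRingModule.compLieHom (Poly n) ((polyRep (Fin n)).comp (Sp n).incl)

instance : LieModule ℂ (Sp n) (Poly n) :=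
  LieModule.compLieHom (Poly n) ((polyRep (Fin n)).comp (Sp n).incl)

lemma lie_eq_polyDeriv (x : Sp n) (f : Poly n) : ⁅x, f⁆ = polyDeriv (Fin n) x.1 f := rfl

/-- The finite-dimensional submodule of the homogeneous polynomials of degree `d`. -/
def homogPoly (n d : ℕ) : LieSubmodule ℂ (Sp n) (Poly n) where
  __ := homogeneousSubmodule _ ℂ d
  lie_mem {x f} hf := by
    refine isHomogeneous_derivation (D := polyDeriv (Fin n) x.1) (fun ⟨a, j⟩ => ?_) hf
    rw [polyDeriv_X]
    exact Submodule.sum_mem (homogeneousSubmodule _ ℂ 1) fun b _ =>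
      Submodule.smul_mem _ _ (isHomogeneous_X _ _)

instance (d : ℕ) : FiniteDimensional ℂ (homogPoly n d) :=
  Module.Finite.iff_fg.2 (homogeneousSubmodule_fg _ ℂ d)

lemma isHighestWeightVector_one : IsHighestWeightVector (Poly n) (0 : Weight n) 1 := by
  have hzero : ∀ x : Sp n, ⁅x, (1 : Poly n)⁆ = 0 := fun x =>
    (polyDeriv (Fin n) x.1).map_one_eq_zero
  refine ⟨one_ne_zero, mem_weightSpace.2 fun h => ?_, fun α _ x _ => hzero x⟩
  rw [hzero, evalWeight_zero, zero_smul]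

lemma IsHighestWeightVector.mul {lam mu : Weight n} {f g : Poly n}
    (hf : IsHighestWeightVector (Poly n) lam f) (hg : IsHighestWeightVector (Poly n) mu g) :
    IsHighestWeightVector (Poly n) (lam + mu) (f * g) := by
  have hleibniz : ∀ x : Sp n, ⁅x, f * g⁆ = f * ⁅x, g⁆ + g * ⁅x, f⁆ := fun x =>
    (polyDeriv (Fin n) x.1).leibniz f g
  refine ⟨mul_ne_zero hf.1 hg.1, mem_weightSpace.2 fun h => ?_, fun α hα x hx => ?_⟩
  · rw [hleibniz, mem_weightSpace.1 hf.2.1, mem_weightSpace.1 hg.2.1, evalWeight_add, add_smul,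
      mul_smul_comm, mul_smul_comm, mul_comm g, add_comm]
  · rw [hleibniz, hf.2.2 α hα x hx, hg.2.2 α hα x hx, mul_zero, mul_zero, add_zero]

/-- The weights of the homogeneous highest weight vectors among the polynomials. -/
def polyHighestWeights (n : ℕ) : AddSubmonoid (Weight n) where
  carrier := {lam | ∃ d, ∃ f : Poly n, f.IsHomogeneous d ∧ IsHighestWeightVector (Poly n) lam f}
  zero_mem' := ⟨0, 1, isHomogeneous_one _ _, isHighestWeightVector_one⟩
  add_mem' := by
    rintro lam mu ⟨d, f, hfd, hf⟩ ⟨e, g, hge, hg⟩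
    exact ⟨d + e, f * g, hfd.mul hge, hf.mul hg⟩

/-- The generic matrix of the coordinates of the covectors `0, …, p` along the basis vectors
`0, …, p`, whose determinant is a highest weight vector of a fundamental weight. -/
def minorMatrix (p : Fin n) : Matrix {i // i ≤ p} {i // i ≤ p} (Poly n) :=
  Matrix.of fun r i => X (.inl i.1, r.1)

lemma minorMatrix_det_ne_zero (p : Fin n) : (minorMatrix p).det ≠ 0 := by
  let ev : Poly n →+* ℂ := eval fun q => if q.1 = .inl q.2 then 1 else 0
  have hone : ev.mapMatrix (minorMatrix p) = 1 := by
    ext r i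
    simp [ev, minorMatrix, Matrix.one_apply, eq_comm, Subtype.ext_iff]
  intro h
  have hdet := congrArg ev h
  rw [RingHom.map_det, hone, Matrix.det_one, map_zero] at hdet
  exact one_ne_zero hdet

lemma polyDeriv_cartan_X (h : Fin n → ℂ) (i j : Fin n) :
    polyDeriv (Fin n) (cartan h).1 (X (.inl i, j)) = h i • X (.inl i, j) := by
  rw [polyDeriv_X, cartan_val, Finset.sum_eq_single (.inl i)]
  · rw [Matrix.diagonal_apply_eq, Sum.elim_inl]
  · intro b _ hb
    rw [Matrix.diagonal_apply_ne _ hb, zero_smul]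
  · simp

lemma polyDeriv_cartan_minor (p : Fin n) (h : Fin n → ℂ) :
    polyDeriv (Fin n) (cartan h).1 (minorMatrix p).det =
      (∑ i : {i // i ≤ p}, h i) • (minorMatrix p).det := by
  rw [derivation_det, Finset.sum_smul]
  refine Finset.sum_congr rfl fun i _ => ?_
  have hcol : (fun r => polyDeriv (Fin n) (cartan h).1 (minorMatrix p r i)) =
      (C (h i) : Poly n) • fun r => minorMatrix p r i := by
    ext1 r
    simp only [minorMatrix, Matrix.of_apply, polyDeriv_cartan_X, smul_eq_C_mul, Pi.smul_apply,
      smul_eq_mul]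
  rw [hcol, Matrix.det_updateCol_smul, Matrix.updateCol_eq_self, smul_eq_C_mul]

lemma wt_sub_wt_eq_of_rootVector {α : Weight n} {x : Sp n}
    (hx : ∀ h : Fin n → ℂ, ⁅cartan h, x⁆ = evalWeight α h • x) {a b : Fin n ⊕ Fin n}
    (hab : x.1 a b ≠ 0) : wt a - wt b = α := by
  apply evalWeight_injective
  ext h
  have hentry : evalWeight (wt a) h * x.1 a b - x.1 a b * evalWeight (wt b) h =
      evalWeight α h * x.1 a b := by
    have hval : ⁅(cartan h).1, x.1⁆ = evalWeight α h • x.1 := congrArg Subtype.val (hx h)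
    simpa only [Ring.lie_def, cartan_val, Matrix.sub_apply, Matrix.diagonal_mul,
      Matrix.mul_diagonal, ← evalWeight_wt, Matrix.smul_apply, smul_eq_mul] using
      congrFun₂ hval a b
  rw [mul_comm (x.1 a b), ← sub_mul, ← evalWeight_sub] at hentry
  exact mul_right_cancel₀ hab hentry

lemma lt_of_positiveRootVector {α : Weight n} (hα : α ∈ positiveRoots n) {x : Sp n}
    (hx : ∀ h : Fin n → ℂ, ⁅cartan h, x⁆ = evalWeight α h • x) {a : Fin n ⊕ Fin n} {i : Fin n}
    (ha : x.1 a (.inl i) ≠ 0) : ∃ l < i, a = .inl l := by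
  have hpos := dotProduct_rho_pos hα
  rw [← wt_sub_wt_eq_of_rootVector hx ha, sub_dotProduct] at hpos
  rcases a with l | l
  · exact ⟨l, rho_strictAnti.lt_iff_gt.1 (by simpa [wt, eps] using hpos), rfl⟩
  · have hneg : 0 < -rho n l - rho n i := by simpa [wt, eps] using hpos
    linarith [rho_pos l, rho_pos i]

lemma polyDeriv_positive_minor (p : Fin n) {α : Weight n} (hα : α ∈ positiveRoots n) {x : Sp n}
    (hx : ∀ h : Fin n → ℂ, ⁅cartan h, x⁆ = evalWeight α h • x) :
    polyDeriv (Fin n) x.1 (minorMatrix p).det = 0 := by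
  rw [derivation_det]
  refine Finset.sum_eq_zero fun i _ => ?_
  by_cases hcol : ∀ a, x.1 a (.inl i.1) = 0
  · refine Matrix.det_eq_zero_of_column_eq_zero i fun r => ?_
    simp [Matrix.updateCol_self, minorMatrix, polyDeriv_X, hcol]
  push Not at hcol
  obtain ⟨a, ha⟩ := hcol
  obtain ⟨l, hl, rfl⟩ := lt_of_positiveRootVector hα hx ha
  let l' : {i // i ≤ p} := ⟨l, hl.le.trans i.2⟩
  have hne : i ≠ l' := fun h => hl.ne' (congrArg Subtype.val h)
  have hcol : (fun r => polyDeriv (Fin n) x.1 (minorMatrix p r i)) =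
      (C (x.1 (.inl l) (.inl i.1)) : Poly n) • fun r => minorMatrix p r l' := by
    ext1 r
    rw [minorMatrix, Matrix.of_apply, polyDeriv_X, Finset.sum_eq_single (.inl l)]
    · exact smul_eq_C_mul _ _
    · intro b _ hbl
      by_contra hb
      refine hbl (wt_injective (sub_left_injective (b := wt (.inl i.1)) ?_))
      exact (wt_sub_wt_eq_of_rootVector hx (left_ne_zero_of_smul hb)).trans
        (wt_sub_wt_eq_of_rootVector hx ha).symm
    · simp
  rw [hcol, Matrix.det_updateCol_smul, Matrix.det_zero_of_column_eq hne, mul_zero]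
  intro r
  rw [Matrix.updateCol_self, Matrix.updateCol_ne hne.symm]

/-- The fundamental weight `ε_0 + ⋯ + ε_p`. -/
def fundamentalWeight (p : Fin n) : Weight n := fun i => if i ≤ p then 1 else 0

lemma fundamentalWeight_mem_polyHighestWeights (p : Fin n) :
    fundamentalWeight p ∈ polyHighestWeights n := by
  refine ⟨_, (minorMatrix p).det, isHomogeneous_det fun _ _ => isHomogeneous_X _ _,
    minorMatrix_det_ne_zero p, mem_weightSpace.2 fun h => ?_,
    fun α hα x hx => polyDeriv_positive_minor p hα hx⟩
  have heval : evalWeight (fundamentalWeight p) h = ∑ i : {i // i ≤ p}, h i := by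
    simp only [evalWeight, fundamentalWeight, Int.cast_ite, Int.cast_one, Int.cast_zero, ite_mul,
      one_mul, zero_mul, ← Finset.sum_filter]
    exact Finset.sum_subtype _ (by simp) _
  rw [lie_eq_polyDeriv, polyDeriv_cartan_minor, heval]

lemma exists_eq_sum_smul_fundamentalWeight {lam : Weight n} (hlam : IsDominant lam) :
    ∃ m : Fin n → ℕ, lam = ∑ p, m p • fundamentalWeight p := by
  let ext (i : ℕ) : ℤ := if h : i < n then lam ⟨i, h⟩ else 0
  have hanti : ∀ i, ext (i + 1) ≤ ext i := by
    intro i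
    simp only [ext]
    split_ifs with h h'
    · exact hlam.1 (Nat.le_succ i)
    · lia
    · exact hlam.2 _
    · rfl
  have hlast : ext n = 0 := dif_neg (lt_irrefl n)
  refine ⟨fun p => (ext p - ext (p + 1)).toNat, funext fun i => ?_⟩
  have htelescope : ∑ p ∈ Finset.Ico (i : ℕ) n, (ext p - ext (p + 1)) = ext i - ext n := by
    rw [← neg_inj, ← Finset.sum_neg_distrib]
    simpa only [neg_sub] using Finset.sum_Ico_sub ext i.2.le
  have hext : ext i = lam i := dif_pos i.2
  calc lam i = ext i := hext.symm
    _ = ∑ p ∈ Finset.Ico (i : ℕ) n, (ext p - ext (p + 1)) := by rw [htelescope, hlast, sub_zero]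
    _ = ∑ p ∈ Finset.range n, if (i : ℕ) ≤ p then ext p - ext (p + 1) else 0 := by
      rw [← Finset.sum_filter]
      congr 1
      ext p
      simp only [Finset.mem_Ico, Finset.mem_filter, Finset.mem_range, and_comm]
    _ = ∑ p : Fin n, if i ≤ p then ext p - ext (p + 1) else 0 := Finset.sum_range _
    _ = _ := by
      rw [Finset.sum_apply]
      refine Finset.sum_congr rfl fun p _ => ?_
      rw [Pi.smul_apply, fundamentalWeight, nsmul_eq_mul,
        Int.toNat_of_nonneg (sub_nonneg.2 (hanti p)), mul_ite, mul_one, mul_zero]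

theorem nonempty_simpleModule_of_isDominant {lam : Weight n} (hlam : IsDominant lam) :
    Nonempty (SimpleModuleOfHighestWeight n lam) := by
  obtain ⟨m, rfl⟩ := exists_eq_sum_smul_fundamentalWeight hlam
  obtain ⟨d, f, hfd, hf⟩ : ∑ p, m p • fundamentalWeight p ∈ polyHighestWeights n :=
    sum_mem fun p _ => nsmul_mem (fundamentalWeight_mem_polyHighestWeights p) (m p)
  exact nonempty_simpleModule (v := (⟨f, hfd⟩ : homogPoly n d))
    (.of_map (homogPoly n d).incl (homogPoly n d).injective_incl hf)

end PolynomialModule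

/-! ### The expansion of `G_{n,k}` into characters -/

section Expansion

variable {n : ℕ}

lemma weylDenom_mul_chi {lam : Weight n} (hlam : IsDominant lam) :
    weylDenom (xvar n) * chi lam = alternant (xvar n) (lam + rho n) := by
  have hne := nonempty_simpleModule_of_isDominant hlam
  have := hne.some.finiteDimensional
  have := hne.some.irreducible
  obtain ⟨v, hv⟩ := hne.some.exists_highestWeightVector
  rw [chi, dif_pos hne]
  exact weylDenom_mul_character hv hlam

lemma isDominant_hookWeight {k r : ℕ} (hrk : r < k) : IsDominant (hookWeight n k r) := by
  refine ⟨fun i j hij => ?_, fun i => ?_⟩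
  · have : (i : ℕ) ≤ j := hij
    simp only [hookWeight]
    split_ifs <;> lia
  · simp only [hookWeight]
    split_ifs <;> lia

lemma weylDenom_mul_chi_hookWeight {k r : ℕ} (hrk : r < k) :
    weylDenom (xvar n) * chi (hookWeight n k r) =
      alternant (xvar n) (hookWeight n k r + rho n) :=
  weylDenom_mul_chi (isDominant_hookWeight hrk)

lemma q_ne_zero : q n ≠ 0 := by
  rw [q, Ne, FaithfulSMul.algebraMap_eq_zero_iff, FaithfulSMul.algebraMap_eq_zero_iff]
  exact RatFunc.X_ne_zero

lemma weylDenom_mul_ChG (k : ℕ) :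
    weylDenom (xvar n) * ChG n k =
      ∑ j, (q n ^ (2 * rho n j) *
          alternant (xvar n) (Function.update (rho n) j (rho n j + k)) +
        q n ^ (-(2 * rho n j)) *
          alternant (xvar n) (Function.update (rho n) j (rho n j - k))) := by
  rw [← weylDenom_mul_G (xvar n) xvar_ne_zero weylDenom_xvar_ne_zero q_ne_zero k, ChG]
  congr 2
  funext a
  rw [epsIdx, expo_zsmul]
  rfl

lemma sum_Icc_eq_sum_fin {M : Type*} [AddCommMonoid M] (f : ℕ → M) :
    ∑ r ∈ Finset.Icc (n + 1) (2 * n), f r = ∑ j : Fin n, f (2 * n - j) := by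
  rw [← Finset.Ico_add_one_right_eq_Icc, ← Finset.sum_range fun j => f (2 * n - j),
    Finset.range_eq_Ico, Finset.sum_Ico_reflect f 0 (by lia)]
  congr 2
  lia

lemma two_mul_sub_two_mul (j : Fin n) : 2 * (n : ℤ) - 2 * (j : ℕ) = 2 * rho n j := by
  simp only [rho]
  ring

lemma two_mul_sub_two_mul_reflect (j : Fin n) :
    2 * (n : ℤ) - 2 * ((2 * n - j : ℕ) : ℤ) = -(2 * rho n j) := by
  rw [Nat.cast_sub (by lia)]
  simp only [rho]
  push_cast
  ring

theorem ChG_zero :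
    ChG n 0 = ∑ r ∈ Finset.range n, q n ^ (2 * (n : ℤ) - 2 * (r : ℤ)) +
      ∑ r ∈ Finset.Icc (n + 1) (2 * n), q n ^ (2 * (n : ℤ) - 2 * (r : ℤ)) := by
  apply mul_left_cancel₀ (weylDenom_xvar_ne_zero (n := n))
  rw [weylDenom_mul_ChG, sum_Icc_eq_sum_fin, Finset.sum_range, ← Finset.sum_add_distrib,
    Finset.mul_sum]
  refine Finset.sum_congr rfl fun j _ => ?_
  rw [two_mul_sub_two_mul, two_mul_sub_two_mul_reflect, Nat.cast_zero, add_zero, sub_zero,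
    Function.update_eq_self, ← weylDenom_eq_alternant _ xvar_ne_zero]
  ring

lemma sum_hookTerm_eq_sum_fin {k : ℕ} (hk : 1 ≤ k) :
    ∑ r ∈ Finset.Icc 0 (min (k - 1) (2 * n)), hookTerm n k r =
      ∑ j : Fin n, ((if (j : ℕ) < k then hookTerm n k j else 0) +
        if 2 * n - j < k then hookTerm n k (2 * n - j) else 0) := by
  have hIcc : Finset.Icc 0 (min (k - 1) (2 * n)) = {r ∈ Finset.range (2 * n + 1) | r < k} := by
    ext r
    simp only [Finset.mem_Icc, Finset.mem_filter, Finset.mem_range]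
    lia
  have hrange : Finset.range (2 * n + 1) =
      insert n (Finset.range n ∪ Finset.Icc (n + 1) (2 * n)) := by
    ext r
    simp only [Finset.mem_insert, Finset.mem_union, Finset.mem_range, Finset.mem_Icc]
    lia
  have hdisj : Disjoint (Finset.range n) (Finset.Icc (n + 1) (2 * n)) := by
    refine Finset.disjoint_left.2 fun r hr hr' => ?_
    rw [Finset.mem_range] at hr
    rw [Finset.mem_Icc] at hr'
    lia
  have hmiddle : hookTerm n k n = 0 := by simp [hookTerm, tau]
  rw [hIcc, Finset.sum_filter, hrange, Finset.sum_insert (by simp), hmiddle, ite_self, zero_add,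
    Finset.sum_union hdisj, sum_Icc_eq_sum_fin, Finset.sum_range, ← Finset.sum_add_distrib]

lemma hookTerm_of_lt {k : ℕ} (j : Fin n) :
    hookTerm n k j = (-1) ^ (j : ℕ) * q n ^ (2 * rho n j) * chi (hookWeight n k j) := by
  rw [hookTerm, tau, if_pos j.2, two_mul_sub_two_mul, Int.cast_one, mul_one]

lemma hookTerm_two_mul_sub {k : ℕ} (j : Fin n) :
    hookTerm n k (2 * n - j) =
      -((-1) ^ (j : ℕ) * q n ^ (-(2 * rho n j)) * chi (hookWeight n k (2 * n - j))) := by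
  have := j.2
  have hsign : (-1 : Frac n) ^ (2 * n - (j : ℕ)) = (-1) ^ (j : ℕ) :=
    neg_one_pow_congr (by grind)
  rw [hookTerm, tau, if_neg (by lia), if_neg (by lia), hsign, two_mul_sub_two_mul_reflect]
  push_cast
  ring

lemma weylDenom_mul_hookTerm_left {k : ℕ} (hk : 1 ≤ k) (j : Fin n) :
    q n ^ (2 * rho n j) * alternant (xvar n) (Function.update (rho n) j (rho n j + k)) =
      weylDenom (xvar n) * if (j : ℕ) < k then hookTerm n k j else 0 := by
  split_ifs with hjk
  · rw [alternant_rho_add_hook, ← weylDenom_mul_chi_hookWeight hjk, hookTerm_of_lt]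
    ring
  · rw [alternant_rho_add_eq_zero _ _ hk (not_lt.1 hjk), mul_zero, mul_zero]

lemma weylDenom_mul_hookTerm_right {k : ℕ} (hk : 1 ≤ k) (j : Fin n) :
    q n ^ (-(2 * rho n j)) * alternant (xvar n) (Function.update (rho n) j (rho n j - k)) =
      weylDenom (xvar n) * ((if 2 * n - j < k then hookTerm n k (2 * n - j) else 0) +
        if k = 2 * (n - j) then -q n ^ (-(k : ℤ)) else 0) := by
  have := j.2
  by_cases hjk : 2 * n - j < k
  · rw [if_pos hjk, if_neg (by lia), add_zero, alternant_rho_sub_hook,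
      ← weylDenom_mul_chi_hookWeight hjk, hookTerm_two_mul_sub]
    ring
  rw [if_neg hjk, zero_add]
  split_ifs with hreflect
  · have hexp : 2 * rho n j = k := by
      simp only [rho]
      lia
    rw [hexp, hreflect, alternant_rho_sub_eq_neg, ← weylDenom_eq_alternant _ xvar_ne_zero]
    ring
  · rw [alternant_rho_sub_eq_zero _ _ hk (not_lt.1 hjk) hreflect, mul_zero, mul_zero]

lemma sum_fin_ite_eq_two_mul_sub {M : Type*} [AddCommMonoid M] {k : ℕ} (hk : 1 ≤ k) (c : M) :
    (∑ j : Fin n, if k = 2 * (n - j) then c else 0) = if k ≤ 2 * n ∧ Even k then c else 0 := by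
  split_ifs with h
  · obtain ⟨hkn, l, rfl⟩ := h
    rw [Finset.sum_eq_single (⟨n - l, by lia⟩ : Fin n), if_pos (by simp only; lia)]
    · intro j _ hj
      refine if_neg fun heq => hj (Fin.ext ?_)
      have := j.2
      simp only
      lia
    · simp
  · exact Finset.sum_eq_zero fun j _ => if_neg fun heq => h ⟨by lia, n - j, by lia⟩

theorem ChG_of_pos {k : ℕ} (hk : 1 ≤ k) :
    ChG n k = ∑ r ∈ Finset.Icc 0 (min (k - 1) (2 * n)), hookTerm n k r +
      if k ≤ 2 * n ∧ Even k then -q n ^ (-(k : ℤ)) else 0 := by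
  apply mul_left_cancel₀ (weylDenom_xvar_ne_zero (n := n))
  rw [weylDenom_mul_ChG, sum_hookTerm_eq_sum_fin hk, ← sum_fin_ite_eq_two_mul_sub hk,
    ← Finset.sum_add_distrib, Finset.mul_sum]
  refine Finset.sum_congr rfl fun j _ => ?_
  rw [weylDenom_mul_hookTerm_left hk, weylDenom_mul_hookTerm_right hk]
  ring

end Expansion

end

end TypeC

theorem theorem3p6_general (n k : ℕ) :
    (k = 0 →
      TypeC.ChG n k =
        ∑ r ∈ Finset.range n, TypeC.q n ^ (2 * (n : ℤ) - 2 * (r : ℤ)) +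
          ∑ r ∈ Finset.Icc (n + 1) (2 * n), TypeC.q n ^ (2 * (n : ℤ) - 2 * (r : ℤ))) ∧
    (1 ≤ k ∧ k ≤ 2 * n ∧ Even k →
      TypeC.ChG n k =
        -(TypeC.q n ^ (-(k : ℤ))) + ∑ r ∈ Finset.Icc 0 (k - 1), TypeC.hookTerm n k r) ∧
    (1 ≤ k ∧ ¬(k ≤ 2 * n ∧ Even k) →
      TypeC.ChG n k = ∑ r ∈ Finset.Icc 0 (min (k - 1) (2 * n)), TypeC.hookTerm n k r) := by
  refine ⟨?_, ?_, ?_⟩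
  · rintro rfl
    exact TypeC.ChG_zero
  · rintro ⟨hk, hkn, heven⟩
    rw [TypeC.ChG_of_pos hk, if_pos ⟨hkn, heven⟩, min_eq_left (by lia), add_comm]
  · rintro ⟨hk, hkn⟩
    rw [TypeC.ChG_of_pos hk, if_neg hkn, add_zero]

theorem theorem3p6 (n k : ℕ) (hn : 3 ≤ n) :
    (k = 0 →
      TypeC.ChG n k =
        ∑ r ∈ Finset.range n, TypeC.q n ^ (2 * (n : ℤ) - 2 * (r : ℤ)) +
          ∑ r ∈ Finset.Icc (n + 1) (2 * n), TypeC.q n ^ (2 * (n : ℤ) - 2 * (r : ℤ))) ∧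
    (1 ≤ k ∧ k ≤ 2 * n ∧ Even k →
      TypeC.ChG n k =
        -(TypeC.q n ^ (-(k : ℤ))) + ∑ r ∈ Finset.Icc 0 (k - 1), TypeC.hookTerm n k r) ∧
    (1 ≤ k ∧ ¬(k ≤ 2 * n ∧ Even k) →
      TypeC.ChG n k = ∑ r ∈ Finset.Icc 0 (min (k - 1) (2 * n)), TypeC.hookTerm n k r) :=
  theorem3p6_general n k
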